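/- Theorem B (Linearization of hyperbolic complex Dulac germs). Notation: $\mathbb C^+=\{\Re\zeta>0\}$; for $C>0$ the standard quadratic domain is $\mathcal R_C=\kappa(\mathbb C^+)$, $\kappa(\zeta)=\zeta+C(\zeta+1)^{1/2}$ (principal branch), and for $R>0$, $(\mathcal R_C)_R=\{\zeta\in\mathcal R_C:\Re\zeta\ge R\}$ are its germs. A complex Dulac germ on $\mathcal R_C$ is a germ of holomorphic map $f$ on $\mathcal R_C$ (represented on some $(\mathcal R_C)_R$) for which there are $\alpha>0$, $b\in\mathbb C$, polynomials $P_i\in\mathbb C[\zeta]$ and a strictly increasing sequence $(\alpha_i)_{i\ge1}$ of positive reals, tending to $+\infty$ and contained in a finitely generated sub-semigroup of $(\mathbb R_{>0},+)$, such that for every $\nu>0$ there is $N_\nu\in\mathbb N$ with $$f(\zeta)-\alpha\zeta-b-\sum_{i=1}^{N_\nu}P_i(\zeta)e^{-\alpha_i\zeta}=o(e^{-\nu\zeta})\quad\text{uniformly on }\mathcal R_C\text{ as }\Re\zeta\to+\infty .$$ It is called a parabolic Dulac germ if this holds with $\alpha=1$, $b=0$, and a real Dulac germ if, as a germ, it maps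 real points of $\mathcal R_C$ to real points of $\mathcal R_C$. A germ $\varphi$ is tangent to the identity if $\varphi(\zeta)=\zeta+o(1)$ uniformly as $\Re\zeta\to+\infty$. Let $f$ be a complex Dulac germ on $\mathcal R_C$ with $f(\zeta)=\zeta+\beta+o(1)$ uniformly as $\Re\zeta\to+\infty$, where $\Re\beta>0$. Then there is $R_0>0$ such that $(\mathcal R_C)_R$ is $f$-invariant for every $R\ge R_0$, and there is a holomorphic map $\varphi$ on $(\mathcal R_C)_{R_0}$, tangent to the identity, such that $$\varphi\circ f=\varphi+\beta\quad\text{on }(\mathcal R_C)_{R_0}.$$ It is unique as a germ: if $(\mathcal R_C)_R$, $R>0$, is $f$-invariant and $\psi$ is holomorphic on $(\mathcal R_C)_R$, tangent to the identity, and $\psi\circ f=\psi+\beta$ there, then $\psi=\varphi$ on $(\mathcal R_C)_R\cap(\mathcal R_C)_{R_0}$. Unless $f$ is the germ of the translation $\zeta\mapsto\zeta+\beta$, no iterate $\varphi^{\circ q}$, $q\ge1$, is the germ of the identity, so that $\varphi$ is a parabolic germ. Moreover, there is $C'\ge C$ with $\mathcal R_{C'}\subseteq(\mathcal R_C)_{R_0}$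 such that $\varphi$ is a parabolic complex Dulac germ on $\mathcal R_{C'}$. If $f$ is a real Dulac germ, then $\varphi$ is also a real Dulac germ on $\mathcal R_{C'}$, and it has an expansion as above with $\alpha=1$, $b=0$ and all $P_i\in\mathbb R[\zeta]$. -/

import Mathlib

open Filter Topology

noncomputable section

namespace Dulac

/-- The map `κ(ζ) = ζ + C (ζ + 1)^{1/2}` (principal branch). -/
def kappa (C : ℝ) (ζ : ℂ) : ℂ := ζ + (C : ℂ) * (ζ + 1) ^ (1 / 2 : ℂ)

/-- The standard quadratic domain `R_C = κ(ℂ⁺)`, in the logarithmic chart. -/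
def quadDomain (C : ℝ) : Set ℂ := kappa C '' {ζ : ℂ | 0 < ζ.re}

/-- The germ `(R_C)_R = R_C ∩ {Re ζ ≥ R}` of the standard quadratic domain `R_C`. -/
def quadGerm (C R : ℝ) : Set ℂ := quadDomain C ∩ {ζ : ℂ | R ≤ ζ.re}

/-- The filter of `Re ζ → +∞` in `R_C`; limits along it are uniform in `Im ζ`. -/
def atInfty (C : ℝ) : Filter ℂ := comap Complex.re atTop ⊓ 𝓟 (quadDomain C)

/-- A complex Dulac series `α ζ + β + ∑_{i ≥ 0} P_i(ζ) exp(-a_i ζ)`. The polynomials `P_i` may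
vanish, so finite sums are included. -/
structure Series where
  α : ℝ
  β : ℂ
  P : ℕ → Polynomial ℂ
  a : ℕ → ℝ
  α_pos : 0 < α
  a_pos : ∀ i, 0 < a i
  a_strictMono : StrictMono a
  a_tendsto : Tendsto a atTop atTop
  a_fg : ∃ s : Finset ℝ, (∀ x ∈ s, 0 < x) ∧ ∀ i, a i ∈ AddSubsemigroup.closure (s : Set ℝ)

/-- A parabolic Dulac series: `α = 1` and `β = 0`. -/
def Series.IsParabolic (S : Series) : Prop := S.α = 1 ∧ S.β = 0

/-- A real Dulac series: `β` is a nonnegative real and all the polynomials are real. -/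
def Series.IsReal (S : Series) : Prop :=
  (∃ b : ℝ, 0 ≤ b ∧ S.β = (b : ℂ)) ∧
    ∀ i, ∃ Q : Polynomial ℝ, S.P i = Q.map (algebraMap ℝ ℂ)

/-- The partial sum of a Dulac series with its first `N` exponential terms. -/
def Series.partialSum (S : Series) (N : ℕ) (ζ : ℂ) : ℂ :=
  (S.α : ℂ) * ζ + S.β +
    ∑ i ∈ Finset.range N, (S.P i).eval ζ * Complex.exp (-((S.a i : ℂ) * ζ))

/-- `f` admits the Dulac series `S` as its asymptotic expansion, uniformly on `R_C`. -/
def HasExpansion (C : ℝ) (f : ℂ → ℂ) (S : Series) : Prop :=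
  ∀ ν : ℝ, 0 < ν → ∃ N : ℕ,
    (fun ζ => f ζ - S.partialSum N ζ) =o[atInfty C] fun ζ => Complex.exp (-((ν : ℂ) * ζ))

/-- `f` represents a holomorphic germ on `R_C`: it is holomorphic on some `(R_C)_R`
(which is `R_C` itself if `R ≤ C`), that is, on a neighbourhood of each of its points. -/
def IsHolomorphicGerm (C : ℝ) (f : ℂ → ℂ) : Prop :=
  ∃ R : ℝ, 0 < R ∧ AnalyticOnNhd ℂ f (quadGerm C R)

/-- `f` represents a complex Dulac germ on `R_C`. -/
def IsComplexDulacGerm (C : ℝ) (f : ℂ → ℂ) : Prop :=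
  IsHolomorphicGerm C f ∧ ∃ S : Series, HasExpansion C f S

/-- `f` represents a parabolic complex Dulac germ on `R_C`. -/
def IsParabolicDulacGerm (C : ℝ) (f : ℂ → ℂ) : Prop :=
  IsHolomorphicGerm C f ∧ ∃ S : Series, S.IsParabolic ∧ HasExpansion C f S

/-- As a germ, `f` maps the real points of `R_C` to real points of `R_C`. -/
def PreservesRealPoints (C : ℝ) (f : ℂ → ℂ) : Prop :=
  ∃ R : ℝ, 0 < R ∧ ∀ ζ ∈ quadGerm C R, ζ.im = 0 → f ζ ∈ quadDomain C ∧ (f ζ).im = 0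

/-- `f` represents a real Dulac germ on `R_C`. -/
def IsRealDulacGerm (C : ℝ) (f : ℂ → ℂ) : Prop :=
  IsComplexDulacGerm C f ∧ PreservesRealPoints C f

/-- `(R_C)_R` is `f`-invariant, and `φ` is a holomorphic map on `(R_C)_R`, tangent to the
identity, that satisfies `φ ∘ f = φ + β` there. -/
structure IsLinearizationOn (C R : ℝ) (f : ℂ → ℂ) (β : ℂ) (φ : ℂ → ℂ) : Prop where
  invariant : Set.MapsTo f (quadGerm C R) (quadGerm C R)
  analytic : AnalyticOnNhd ℂ φ (quadGerm C R)
  tangent : Tendsto (fun ζ => φ ζ - ζ) (atInfty C) (𝓝 0)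
  linearizes : ∀ ζ ∈ quadGerm C R, φ (f ζ) = φ ζ + β

/-- For a map `φ` given on `(R_C)_R`: no iterate `φ^{∘q}`, `q ≥ 1`, is the identity as a germ at
infinity, where `φ^{∘q}` is looked at only at points whose orbit does not leave `(R_C)_R` before
the last step. -/
def NoIterateIsId (C R : ℝ) (φ : ℂ → ℂ) : Prop :=
  ∀ q : ℕ, 1 ≤ q → ∀ R' : ℝ, ∃ ζ ∈ quadGerm C R',
    (∀ j < q, φ^[j] ζ ∈ quadGerm C R) ∧ φ^[q] ζ ≠ ζ

end Dulac

end

noncomputable section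

open Asymptotics ComplexConjugate

namespace Dulac

/-! Write `g(ζ) = f(ζ) - ζ - β`. The Dulac expansion gives `g = O(exp(-ε Re ζ))` for each `ε` below
the first exponent. Far to the right, `f` raises `Re ζ` by at least `Re β / 2` with bounded vertical
displacement, while the slices of `R_C` widen; so far germs are invariant and `∑ g ∘ fⁿ` converges
geometrically. Adding the identity to this sum gives `φ`, and the conjugacy is a telescoping. The
rest of the analysis uses one estimate, `Pushes.norm_le_of_coboundary`: if `r → 0` and `r ∘ f - r =
O(exp(-ν Re ζ))`, then `r` has the same order. With zero right-hand side it gives uniqueness, and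
the symmetry of `φ` under conjugation when `f` is real. With general `ν` it gives the expansion:
`exists_approx_linearization` builds exponential sums `u` such that `id + u` linearizes `f` up to
that order, and the estimate is applied to `φ - id - u`. These `u` come from `v(ζ + β) - v(ζ) =
w(ζ)`, which is triangular on `ζ^m exp(-aζ)` with diagonal `exp(-aβ) - 1 ≠ 0`. Asymptotic
independence (`eq_zero_of_evalSum_isBigO`) glues the approximations into one series. If an iterate
of `φ` is the identity, `q` almost equal steps add up to zero, so `φ = id` on a disc, hence on the
whole germ, and `f` is a translation. -/

/-! ### Geometry of the standard quadratic domain -/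

/-- Half the height of the vertical slice of `R_C` at real part `x`. -/
def halfWidth (C x : ℝ) : ℝ := (2 * x / C ^ 2 + 1) * √(x ^ 2 - C ^ 2)

/-- With `s` the principal root of `z + 1`, the map `κ` becomes a quadratic polynomial in `s`. -/
lemma mem_quadDomain_iff_exists_sqrt {C : ℝ} {ζ : ℂ} :
    ζ ∈ quadDomain C ↔ ∃ s : ℂ, 0 < s.re ∧ 1 < (s ^ 2).re ∧ ζ = s ^ 2 - 1 + C * s := by
  constructor
  · rintro ⟨z, hz, rfl⟩
    have hz : 0 < z.re := hz
    refine ⟨(z + 1) ^ (2⁻¹ : ℂ), ?_, ?_, ?_⟩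
    · rw [Complex.cpow_inv_two_re]
      apply Real.sqrt_pos.2
      have : 0 < (z + 1).re := by simp; linarith
      positivity
    · rw [Complex.cpow_ofNat_inv_pow]
      simpa using hz
    · rw [Complex.cpow_ofNat_inv_pow]
      simp [kappa]
  · rintro ⟨s, hs, hs2, rfl⟩
    refine ⟨s ^ 2 - 1, by simpa using hs2, ?_⟩
    have : (s ^ 2) ^ (2⁻¹ : ℂ) = s := Complex.sq_cpow_two_inv hs
    simp [kappa, this]

/-- For `s = a + ib` one has `x = a² - b² - 1 + Ca` and `y = b(2a + C)`, and `1 < Re s²` says `Ca <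
x`. On the boundary `a = x/C` and `b² = a² - 1`, which gives `|y| = halfWidth C x`. -/
theorem mem_quadDomain_iff {C : ℝ} (hC : 0 < C) {ζ : ℂ} :
    ζ ∈ quadDomain C ↔ C < ζ.re ∧ |ζ.im| < halfWidth C ζ.re := by
  rw [mem_quadDomain_iff_exists_sqrt]
  constructor
  · rintro ⟨s, hs, hs2, rfl⟩
    obtain ⟨a, b⟩ := s
    simp only [pow_two, Complex.mul_re, Complex.sub_re, Complex.add_re, Complex.one_re,
      Complex.ofReal_re, Complex.ofReal_im, Complex.mul_im, Complex.sub_im, Complex.add_im,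
      Complex.one_im, zero_mul, sub_zero] at *
    have ha : 1 < a := by nlinarith [mul_self_nonneg b]
    have hx : C * a < a * a - b * b - 1 + C * a := by linarith
    set x := a * a - b * b - 1 + C * a with hxdef
    have hCa : C < C * a := by nlinarith
    refine ⟨by linarith, ?_⟩
    have hb : |b| < √(a ^ 2 - 1) := by
      apply Real.lt_sqrt_of_sq_lt
      rw [sq_abs]; nlinarith
    have h1 : √(a ^ 2 - 1) ≤ √(x ^ 2 - C ^ 2) / C := by
      rw [le_div_iff₀ hC]
      apply Real.le_sqrt_of_sq_le
      rw [mul_pow, Real.sq_sqrt (by nlinarith)]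
      nlinarith [mul_pos hC (by linarith : 0 < a)]
    have h2 : (2 * a + C) / C ≤ 2 * x / C ^ 2 + 1 := by
      have : (2 * a + C) / C = 2 * (C * a) / C ^ 2 + 1 := by field_simp
      rw [this]
      gcongr
    have h3 : |a * b + b * a + (C * b + 0)| = |b| * (2 * a + C) := by
      have : a * b + b * a + (C * b + 0) = b * (2 * a + C) := by ring
      rw [this, abs_mul, abs_of_pos (by linarith : 0 < 2 * a + C)]
    have h4 : 0 < 2 * a + C := by linarith
    have hgoal : |a * b + b * a - 0 + (C * b + 0 * a)| < halfWidth C x := by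
      have h5 : a * b + b * a - 0 + (C * b + 0 * a) = a * b + b * a + (C * b + 0) := by ring
      rw [h5, h3]
      calc |b| * (2 * a + C) < (√(x ^ 2 - C ^ 2) / C) * (2 * a + C) := by
            apply mul_lt_mul_of_pos_right (hb.trans_le h1) h4
        _ = ((2 * a + C) / C) * √(x ^ 2 - C ^ 2) := by ring
        _ ≤ halfWidth C x := by unfold halfWidth; gcongr
    convert hgoal using 2
    ring
  · rintro ⟨hx, hy⟩
    -- Completing the square: `s + C/2` is a square root of `ζ + C²/4 + 1`.
    set w : ℂ := (ζ + ((C ^ 2 / 4 + 1 : ℝ) : ℂ)) ^ (2⁻¹ : ℂ) with hw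
    have hw2 : w ^ 2 = ζ + ((C ^ 2 / 4 + 1 : ℝ) : ℂ) := Complex.cpow_ofNat_inv_pow _ _
    have hwre : 0 ≤ w.re := by rw [hw, Complex.cpow_inv_two_re]; positivity
    clear_value w
    obtain ⟨A, b⟩ := w
    obtain ⟨x, y⟩ := ζ
    have e1 := congrArg Complex.re hw2
    have e2 := congrArg Complex.im hw2
    simp only [pow_two, Complex.mul_re, Complex.add_re, Complex.ofReal_re, Complex.ofReal_im,
      Complex.mul_im, Complex.add_im, add_zero] at e1 e2 hwre hx hy
    have hA : C / 2 < A := by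
      apply lt_of_pow_lt_pow_left₀ 2 hwre
      nlinarith [mul_self_nonneg b]
    refine ⟨⟨A - C / 2, b⟩, by simpa using hA, ?_, ?_⟩
    · simp only [pow_two, Complex.mul_re]
      by_contra! hcon
      have ha : x ≤ C * (A - C / 2) := by nlinarith
      have hxC : x / C ≤ A - C / 2 := by rw [div_le_iff₀ hC]; linarith
      have hb : √(x ^ 2 - C ^ 2) ≤ C * |b| := by
        apply Real.sqrt_le_iff.2 ⟨by positivity, ?_⟩
        rw [mul_pow, sq_abs]
        nlinarith [mul_pos hC hC, mul_self_nonneg b, mul_le_mul ha ha (by linarith) (by nlinarith)]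
      have hy' : |y| = |b| * (2 * A) := by
        rw [← e2, show A * b + b * A = b * (2 * A) by ring, abs_mul,
          abs_of_nonneg (by linarith : 0 ≤ 2 * A)]
      have : halfWidth C x ≤ |y| := by
        calc halfWidth C x ≤ (2 * x / C ^ 2 + 1) * (C * |b|) := by
              unfold halfWidth
              have : 0 < x := by linarith
              gcongr
          _ = |b| * (2 * (x / C) + C) := by field_simp
          _ ≤ |b| * (2 * A) := by gcongr; linarith
          _ = |y| := hy'.symm
      linarith
    · apply Complex.ext
      · simp [pow_two]
        nlinarith
      · simp [pow_two]
        nlinarith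

lemma quadDomain_anti {C C' : ℝ} (hC : 0 < C) (h : C ≤ C') : quadDomain C' ⊆ quadDomain C := by
  intro ζ hζ
  rw [mem_quadDomain_iff hC]
  rw [mem_quadDomain_iff (hC.trans_le h)] at hζ
  refine ⟨h.trans_lt hζ.1, hζ.2.trans_le ?_⟩
  have : 0 < ζ.re := by linarith [hζ.1]
  unfold halfWidth
  gcongr

lemma continuous_halfWidth (C : ℝ) : Continuous (halfWidth C) := by
  unfold halfWidth
  fun_prop

lemma isOpen_quadDomain {C : ℝ} (hC : 0 < C) : IsOpen (quadDomain C) := by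
  have : quadDomain C = {ζ : ℂ | C < ζ.re} ∩ {ζ : ℂ | |ζ.im| < halfWidth C ζ.re} := by
    ext ζ; exact mem_quadDomain_iff hC
  rw [this]
  exact (isOpen_lt continuous_const Complex.continuous_re).inter
    (isOpen_lt (by fun_prop) ((continuous_halfWidth C).comp Complex.continuous_re))

lemma halfWidth_pos {C x : ℝ} (hC : 0 < C) (hx : C < x) : 0 < halfWidth C x := by
  unfold halfWidth
  have : 0 < x := hC.trans hx
  have : 0 < x ^ 2 - C ^ 2 := by nlinarith
  positivity

lemma ofReal_mem_quadDomain {C x : ℝ} (hC : 0 < C) (hx : C < x) : (x : ℂ) ∈ quadDomain C := by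
  rw [mem_quadDomain_iff hC]
  simpa using ⟨hx, halfWidth_pos hC hx⟩

lemma conj_mem_quadDomain {C : ℝ} (hC : 0 < C) {ζ : ℂ} (h : ζ ∈ quadDomain C) :
    (starRingEnd ℂ) ζ ∈ quadDomain C := by
  rw [mem_quadDomain_iff hC] at h ⊢
  simpa using h

lemma conj_mem_quadGerm {C R : ℝ} (hC : 0 < C) {ζ : ℂ} (h : ζ ∈ quadGerm C R) :
    (starRingEnd ℂ) ζ ∈ quadGerm C R :=
  ⟨conj_mem_quadDomain hC h.1, by simpa using h.2⟩

lemma quadGerm_anti {C R R' : ℝ} (h : R ≤ R') : quadGerm C R' ⊆ quadGerm C R :=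
  fun _ hζ => ⟨hζ.1, h.trans hζ.2⟩

/-- Each point is joined vertically to the real ray of the germ. This is what the identity theorem
needs. -/
lemma isPreconnected_quadGerm {C : ℝ} (hC : 0 < C) (R : ℝ) : IsPreconnected (quadGerm C R) := by
  have hreal : Complex.ofReal '' (Set.Ici R ∩ Set.Ioi C) ⊆ quadGerm C R := by
    rintro _ ⟨x, ⟨h1, h2⟩, rfl⟩
    exact ⟨ofReal_mem_quadDomain hC h2, h1⟩
  have hpre : IsPreconnected (Complex.ofReal '' (Set.Ici R ∩ Set.Ioi C)) :=
    (((convex_Ici R).inter (convex_Ioi C)).isPreconnected).image _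
      Complex.continuous_ofReal.continuousOn
  have hx0 : max R C + 1 ∈ Set.Ici R ∩ Set.Ioi C :=
    ⟨by simp only [Set.mem_Ici]; linarith [le_max_left R C],
      by simp only [Set.mem_Ioi]; linarith [le_max_right R C]⟩
  refine isPreconnected_of_forall ((max R C + 1 : ℝ) : ℂ) fun ζ hζ => ?_
  refine ⟨segment ℝ ζ (ζ.re : ℂ) ∪ Complex.ofReal '' (Set.Ici R ∩ Set.Ioi C), ?_,
    Or.inr ⟨_, hx0, rfl⟩, Or.inl (left_mem_segment ℝ _ _), ?_⟩
  · refine Set.union_subset ?_ hreal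
    rintro _ ⟨a, b, ha, hb, hab, rfl⟩
    have h1 := (mem_quadDomain_iff hC).1 hζ.1
    have hre : (a • ζ + b • (ζ.re : ℂ)).re = ζ.re := by
      simp [← add_mul, hab]
    refine ⟨(mem_quadDomain_iff hC).2 ?_, ?_⟩
    · rw [hre]
      refine ⟨h1.1, ?_⟩
      have : (a • ζ + b • (ζ.re : ℂ)).im = a * ζ.im := by simp
      rw [this, abs_mul, abs_of_nonneg ha]
      nlinarith [abs_nonneg ζ.im, h1.2]
    · exact hζ.2.trans_eq hre.symm
  · refine IsPreconnected.union (ζ.re : ℂ) (right_mem_segment ℝ _ _) ⟨ζ.re, ⟨hζ.2, ?_⟩, rfl⟩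
      (convex_segment _ _).isPreconnected hpre
    exact ((mem_quadDomain_iff hC).1 hζ.1).1

/-! ### The filter at infinity and growth in the domain -/

lemma eventually_atInfty_iff {C : ℝ} {p : ℂ → Prop} :
    (∀ᶠ ζ in atInfty C, p ζ) ↔ ∃ R : ℝ, ∀ ζ ∈ quadGerm C R, p ζ := by
  have hb : (atInfty C).HasBasis (fun _ : ℝ => True) fun R => quadGerm C R := by
    have := ((atTop_basis (α := ℝ)).comap Complex.re).inf_principal (quadDomain C)
    refine this.to_hasBasis (fun R _ => ⟨R, trivial, ?_⟩) (fun R _ => ⟨R, trivial, ?_⟩)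
    · exact fun ζ h => ⟨h.2, h.1⟩
    · exact fun ζ h => ⟨h.2, h.1⟩
  rw [hb.eventually_iff]
  simp

lemma eventually_mem_quadGerm (C R : ℝ) : ∀ᶠ ζ in atInfty C, ζ ∈ quadGerm C R :=
  eventually_atInfty_iff.2 ⟨R, fun _ h => h⟩

lemma tendsto_re_atInfty (C : ℝ) : Tendsto Complex.re (atInfty C) atTop :=
  tendsto_comap.mono_left inf_le_left

lemma tendsto_atInfty_iff {C : ℝ} {ι : Type*} {l : Filter ι} {u : ι → ℂ} :
    Tendsto u l (atInfty C) ↔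
      Tendsto (fun i => (u i).re) l atTop ∧ ∀ᶠ i in l, u i ∈ quadDomain C := by
  simp [atInfty, tendsto_inf, tendsto_comap_iff, Function.comp_def]

lemma tendsto_ofReal_atInfty {C : ℝ} (hC : 0 < C) :
    Tendsto (fun x : ℝ => (x : ℂ)) atTop (atInfty C) := by
  rw [tendsto_atInfty_iff]
  refine ⟨tendsto_id, ?_⟩
  filter_upwards [eventually_gt_atTop C] with x hx using ofReal_mem_quadDomain hC hx

lemma atInfty_anti {C C' : ℝ} (hC : 0 < C) (h : C ≤ C') : atInfty C' ≤ atInfty C :=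
  inf_le_inf_left _ (principal_mono.2 (quadDomain_anti hC h))

lemma norm_le_of_mem_quadDomain {C : ℝ} (hC : 0 < C) :
    ∃ K : ℝ, ∀ ζ ∈ quadDomain C, ‖ζ‖ ≤ K * ζ.re ^ 2 := by
  refine ⟨1 / C + (2 / C ^ 2 + 1 / C), fun ζ hζ => ?_⟩
  obtain ⟨h1, h2⟩ := (mem_quadDomain_iff hC).1 hζ
  have hx : 0 < ζ.re := hC.trans h1
  have hs : √(ζ.re ^ 2 - C ^ 2) ≤ ζ.re := by
    apply Real.sqrt_le_iff.2 ⟨hx.le, by nlinarith⟩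
  have hxx : ζ.re ≤ ζ.re ^ 2 / C := by
    rw [le_div_iff₀ hC]; nlinarith
  calc ‖ζ‖ ≤ |ζ.re| + |ζ.im| := Complex.norm_le_abs_re_add_abs_im ζ
    _ ≤ ζ.re + (2 * ζ.re / C ^ 2 + 1) * ζ.re := by
        rw [abs_of_pos hx]
        have := h2.le
        unfold halfWidth at this
        have h3 : (2 * ζ.re / C ^ 2 + 1) * √(ζ.re ^ 2 - C ^ 2) ≤ (2 * ζ.re / C ^ 2 + 1) * ζ.re := by
          gcongr
        linarith
    _ = ζ.re + (2 / C ^ 2 * ζ.re ^ 2 + ζ.re) := by ring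
    _ ≤ ζ.re ^ 2 / C + (2 / C ^ 2 * ζ.re ^ 2 + ζ.re ^ 2 / C) := by gcongr
    _ = _ := by ring

/-- Translations of bounded height with a definite real part map far points of `R_C` to `R_C`. -/
lemma exists_forall_add_mem_quadDomain {C : ℝ} (hC : 0 < C) {p M : ℝ} (hp : 0 < p) :
    ∃ R : ℝ, ∀ ζ ∈ quadGerm C R, ∀ δ : ℂ, p ≤ δ.re → |δ.im| ≤ M → ζ + δ ∈ quadDomain C := by
  -- Moving right by `p` adds at least `(2p/C²) √(x² - C²)` to the half-width; this `R` makes that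
  -- gain at least `|M|`.
  refine ⟨C + |M| * C ^ 2 / (2 * p), fun ζ hζ δ hδ hM => ?_⟩
  obtain ⟨h1, h2⟩ := (mem_quadDomain_iff hC).1 hζ.1
  have hR : C + |M| * C ^ 2 / (2 * p) ≤ ζ.re := hζ.2
  have hx : 0 < ζ.re := hC.trans h1
  have hq : 0 ≤ |M| * C ^ 2 / (2 * p) := by positivity
  rw [mem_quadDomain_iff hC, Complex.add_re, Complex.add_im]
  refine ⟨by linarith, ?_⟩
  have hs : |M| * C ^ 2 / (2 * p) ≤ √(ζ.re ^ 2 - C ^ 2) := by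
    apply Real.le_sqrt_of_sq_le
    nlinarith
  have hM' : M ≤ 2 * p / C ^ 2 * √(ζ.re ^ 2 - C ^ 2) := by
    calc M ≤ |M| := le_abs_self M
      _ = 2 * p / C ^ 2 * (|M| * C ^ 2 / (2 * p)) := by field_simp
      _ ≤ _ := by gcongr
  calc |ζ.im + δ.im| ≤ |ζ.im| + |δ.im| := abs_add_le _ _
    _ < halfWidth C ζ.re + 2 * p / C ^ 2 * √(ζ.re ^ 2 - C ^ 2) := by linarith
    _ = (2 * (ζ.re + p) / C ^ 2 + 1) * √(ζ.re ^ 2 - C ^ 2) := by unfold halfWidth; ring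
    _ ≤ halfWidth C (ζ.re + δ.re) := by
        unfold halfWidth
        have : ζ.re ≤ ζ.re + δ.re := by linarith
        have : 0 ≤ ζ.re + δ.re := by linarith
        gcongr

/-! ### Dynamics near infinity and the coboundary estimate -/

/-- `f` maps `(R_C)_R` to `R_C` and increases the real part by at least `ρ`. -/
def Pushes (C R ρ : ℝ) (f : ℂ → ℂ) : Prop :=
  ∀ ζ ∈ quadGerm C R, f ζ ∈ quadDomain C ∧ ζ.re + ρ ≤ (f ζ).re

lemma exists_pushes {C : ℝ} (hC : 0 < C) {β : ℂ} (hβ : 0 < β.re) {f : ℂ → ℂ}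
    (hf : Tendsto (fun ζ => f ζ - ζ - β) (atInfty C) (𝓝 0)) :
    ∃ R : ℝ, Pushes C R (β.re / 2) f := by
  obtain ⟨R₁, h1⟩ := exists_forall_add_mem_quadDomain hC (p := β.re / 2)
    (M := |β.im| + β.re / 2) (by positivity)
  obtain ⟨R₂, h2⟩ := eventually_atInfty_iff.1
    (hf.eventually (Metric.ball_mem_nhds 0 (by positivity : 0 < β.re / 2)))
  refine ⟨max R₁ R₂, fun ζ hζ => ?_⟩
  have h3 := h2 ζ (quadGerm_anti (le_max_right _ _) hζ)
  rw [dist_zero_right] at h3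
  have hre := (Complex.abs_re_le_norm _).trans h3.le
  have him := (Complex.abs_im_le_norm _).trans h3.le
  simp only [Complex.sub_re, Complex.sub_im] at hre him
  have hd : β.re / 2 ≤ (f ζ - ζ).re := by
    rw [Complex.sub_re]; linarith [(abs_le.1 hre).1]
  refine ⟨?_, by rw [Complex.sub_re] at hd; linarith⟩
  have := h1 ζ (quadGerm_anti (le_max_left _ _) hζ) (f ζ - ζ) hd ?_
  · simpa using this
  · have : (f ζ - ζ).im = β.im + ((f ζ).im - ζ.im - β.im) := by rw [Complex.sub_im]; ring
    rw [this]
    exact (abs_add_le _ _).trans (by linarith)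

namespace Pushes
variable {C R ρ : ℝ} {f : ℂ → ℂ}

lemma mono (h : Pushes C R ρ f) {R' : ℝ} (hR : R ≤ R') : Pushes C R' ρ f :=
  fun ζ hζ => h ζ (quadGerm_anti hR hζ)

lemma mapsTo (h : Pushes C R ρ f) (hρ : 0 ≤ ρ) : Set.MapsTo f (quadGerm C R) (quadGerm C R) :=
  fun ζ hζ => ⟨(h ζ hζ).1, le_trans (show R ≤ ζ.re from hζ.2) (by linarith [(h ζ hζ).2])⟩

lemma iterate (h : Pushes C R ρ f) (hρ : 0 ≤ ρ) {ζ : ℂ} (hζ : ζ ∈ quadGerm C R) (n : ℕ) :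
    f^[n] ζ ∈ quadGerm C R ∧ ζ.re + n * ρ ≤ (f^[n] ζ).re := by
  induction n with
  | zero => simpa using hζ
  | succ n ih =>
    rw [Function.iterate_succ_apply']
    refine ⟨h.mapsTo hρ ih.1, ?_⟩
    have := (h _ ih.1).2
    push_cast
    linarith [ih.2]

lemma tendsto_iterate (h : Pushes C R ρ f) (hρ : 0 < ρ) {ζ : ℂ} (hζ : ζ ∈ quadGerm C R) :
    Tendsto (fun n => f^[n] ζ) atTop (atInfty C) := by
  rw [tendsto_atInfty_iff]
  refine ⟨?_, Eventually.of_forall fun n => (h.iterate hρ.le hζ n).1.1⟩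
  refine tendsto_atTop_mono (fun n => (h.iterate hρ.le hζ n).2) ?_
  exact tendsto_atTop_add_const_left _ _
    (tendsto_natCast_atTop_atTop.atTop_mul_const hρ)

/-- A function vanishing at infinity whose coboundary is exponentially small is itself
exponentially small. -/
lemma norm_le_of_coboundary (h : Pushes C R ρ f) (hρ : 0 < ρ) {ν K : ℝ} (hν : 0 < ν) (hK : 0 ≤ K)
    {r : ℂ → ℂ} (hr : Tendsto r (atInfty C) (𝓝 0))
    (hrf : ∀ ζ ∈ quadGerm C R, ‖r (f ζ) - r ζ‖ ≤ K * Real.exp (-ν * ζ.re)) :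
    ∀ ζ ∈ quadGerm C R,
      ‖r ζ‖ ≤ K / (1 - Real.exp (-ν * ρ)) * Real.exp (-ν * ζ.re) := by
  intro ζ hζ
  set q := Real.exp (-ν * ρ) with hq
  have hq1 : q < 1 := Real.exp_lt_one_iff.2 (by nlinarith)
  -- `B` solves `K + qB = B`, so `‖r‖ - B exp(-ν Re ζ)` does not decrease along orbits. Its limit
  -- there is `0`, hence it is nonpositive.
  set B := K / (1 - q) with hB
  have hB0 : 0 ≤ B := div_nonneg hK (by linarith)
  have hBq : K + q * B = B := by
    rw [hB]; field_simp [(by linarith : (1 - q) ≠ 0)]; ring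
  set s : ℂ → ℝ := fun ζ => ‖r ζ‖ - B * Real.exp (-ν * ζ.re) with hs
  have hstep : ∀ ζ ∈ quadGerm C R, s ζ ≤ s (f ζ) := by
    intro ζ hζ
    have h1 : ‖r ζ‖ ≤ ‖r (f ζ)‖ + K * Real.exp (-ν * ζ.re) := by
      have := norm_sub_norm_le (r ζ) (r (f ζ))
      rw [norm_sub_rev] at this
      linarith [hrf ζ hζ]
    have h2 : Real.exp (-ν * (f ζ).re) ≤ q * Real.exp (-ν * ζ.re) := by
      rw [hq, ← Real.exp_add]
      apply Real.exp_le_exp.2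
      nlinarith [(h ζ hζ).2]
    have h3 := mul_le_mul_of_nonneg_left h2 hB0
    simp only [hs]
    have h4 : K * Real.exp (-ν * ζ.re) + B * (q * Real.exp (-ν * ζ.re)) =
        B * Real.exp (-ν * ζ.re) := by
      linear_combination Real.exp (-ν * ζ.re) * hBq
    linarith
  have hle : ∀ n, s ζ ≤ s (f^[n] ζ) := by
    intro n
    induction n with
    | zero => simp
    | succ n ih =>
      rw [Function.iterate_succ_apply']
      exact ih.trans (hstep _ (h.iterate hρ.le hζ n).1)
  have hlim : Tendsto s (atInfty C) (𝓝 0) := by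
    have h1 : Tendsto (fun ζ : ℂ => Real.exp (-ν * ζ.re)) (atInfty C) (𝓝 0) :=
      Real.tendsto_exp_atBot.comp
        ((tendsto_re_atInfty C).const_mul_atTop_of_neg (by linarith))
    simpa [hs] using hr.norm.sub (h1.const_mul B)
  have := ge_of_tendsto (hlim.comp (h.tendsto_iterate hρ hζ)) (Eventually.of_forall hle)
  simp only [hs] at this
  linarith

/-- The case `K = 0` of the coboundary estimate; it serves both uniqueness and the reality of `φ`.
-/
lemma eq_zero_of_invariant (h : Pushes C R ρ f) (hρ : 0 < ρ) {r : ℂ → ℂ}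
    (hr : Tendsto r (atInfty C) (𝓝 0)) (hrf : ∀ ζ ∈ quadGerm C R, r (f ζ) = r ζ) :
    ∀ ζ ∈ quadGerm C R, r ζ = 0 := by
  intro ζ hζ
  have := h.norm_le_of_coboundary hρ one_pos le_rfl hr (fun ζ hζ => by simp [hrf ζ hζ]) ζ hζ
  simpa using this

end Pushes

/-! ### The linearizing series -/

/-- The linearizing map `ζ + ∑ₙ g(fⁿ(ζ))`, where `f(ζ) = ζ + β + g(ζ)`. -/
def linearization (β : ℂ) (f : ℂ → ℂ) (ζ : ℂ) : ℂ :=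
  ζ + ∑' n : ℕ, (f (f^[n] ζ) - f^[n] ζ - β)

section Linearization
variable {C R ρ ε K : ℝ} {f : ℂ → ℂ} {β : ℂ}

lemma norm_term_le (h : Pushes C R ρ f) (hρ : 0 < ρ) (hε : 0 < ε) (hK : 0 ≤ K)
    (hg : ∀ ζ ∈ quadGerm C R, ‖f ζ - ζ - β‖ ≤ K * Real.exp (-ε * ζ.re)) {ζ : ℂ}
    (hζ : ζ ∈ quadGerm C R) (n : ℕ) :
    ‖f (f^[n] ζ) - f^[n] ζ - β‖ ≤ K * Real.exp (-ε * ζ.re) * Real.exp (-ε * ρ) ^ n := by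
  obtain ⟨h1, h2⟩ := h.iterate hρ.le hζ n
  refine (hg _ h1).trans ?_
  rw [mul_assoc, ← Real.exp_nat_mul, ← Real.exp_add]
  gcongr
  nlinarith

lemma summable_geometric_exp (hρ : 0 < ρ) (hε : 0 < ε) (c : ℝ) :
    Summable fun n : ℕ => c * Real.exp (-ε * ρ) ^ n :=
  (summable_geometric_of_lt_one (Real.exp_pos _).le
    (Real.exp_lt_one_iff.2 (by nlinarith))).mul_left c

/-- Passing from `ζ` to `f ζ` drops the term `n = 0` of the series, which is `f ζ - ζ - β`. -/
lemma linearization_comp (h : Pushes C R ρ f) (hρ : 0 < ρ) (hε : 0 < ε) (hK : 0 ≤ K)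
    (hg : ∀ ζ ∈ quadGerm C R, ‖f ζ - ζ - β‖ ≤ K * Real.exp (-ε * ζ.re)) {ζ : ℂ}
    (hζ : ζ ∈ quadGerm C R) :
    linearization β f (f ζ) = linearization β f ζ + β := by
  have hs : Summable fun n : ℕ => (f (f^[n] ζ) - f^[n] ζ - β) :=
    .of_norm_bounded (summable_geometric_exp hρ hε _) (norm_term_le h hρ hε hK hg hζ)
  rw [linearization, linearization, hs.tsum_eq_zero_add]
  simp only [Function.iterate_succ_apply, Function.iterate_zero, id]
  ring

lemma tendsto_linearization_sub (h : Pushes C R ρ f) (hρ : 0 < ρ) (hε : 0 < ε) (hK : 0 ≤ K)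
    (hg : ∀ ζ ∈ quadGerm C R, ‖f ζ - ζ - β‖ ≤ K * Real.exp (-ε * ζ.re)) :
    Tendsto (fun ζ => linearization β f ζ - ζ) (atInfty C) (𝓝 0) := by
  have hlim : Tendsto (fun ζ : ℂ => K * Real.exp (-ε * ζ.re) * ∑' n : ℕ, Real.exp (-ε * ρ) ^ n)
      (atInfty C) (𝓝 0) := by
    have h1 : Tendsto (fun ζ : ℂ => Real.exp (-ε * ζ.re)) (atInfty C) (𝓝 0) :=
      Real.tendsto_exp_atBot.comp
        ((tendsto_re_atInfty C).const_mul_atTop_of_neg (by linarith))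
    simpa using (h1.const_mul K).mul_const _
  refine squeeze_zero_norm' ?_ hlim
  filter_upwards [eventually_mem_quadGerm C R] with ζ hζ
  rw [linearization, add_sub_cancel_left, ← tsum_mul_left]
  exact tsum_of_norm_bounded (summable_geometric_exp hρ hε _).hasSum
    (norm_term_le h hρ hε hK hg hζ)

lemma analyticOnNhd_linearization (hC : 0 < C) (h : Pushes C R ρ f) (hρ : 0 < ρ) (hε : 0 < ε)
    (hK : 0 ≤ K) (hg : ∀ ζ ∈ quadGerm C R, ‖f ζ - ζ - β‖ ≤ K * Real.exp (-ε * ζ.re))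
    (hf : AnalyticOnNhd ℂ f (quadGerm C R)) {R' : ℝ} (hR : R < R') :
    AnalyticOnNhd ℂ (linearization β f) (quadGerm C R') := by
  -- `quadGerm` contains its left edge and need not be open. The strict inequality gives an open
  -- invariant set for the Weierstrass theorem, at the price of `R < R'`.
  set U : Set ℂ := quadDomain C ∩ {ζ | R < ζ.re} with hU
  have hUo : IsOpen U :=
    (isOpen_quadDomain hC).inter (isOpen_lt continuous_const Complex.continuous_re)
  have hUR : U ⊆ quadGerm C R := by
    rintro ζ ⟨h1, h2⟩
    have h2 : R < ζ.re := h2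
    exact ⟨h1, h2.le⟩
  have hmap : Set.MapsTo f U U := by
    intro ζ hζ
    have h1 := h ζ (hUR hζ)
    have h2 : R < ζ.re := hζ.2
    exact ⟨h1.1, h2.trans_le (by linarith)⟩
  have hmaps : ∀ n : ℕ, Set.MapsTo (f^[n]) U U := hmap.iterate
  have hfd : DifferentiableOn ℂ f U := (hf.mono hUR).differentiableOn
  have hit : ∀ n : ℕ, DifferentiableOn ℂ (f^[n]) U := by
    intro n
    induction n with
    | zero => exact differentiableOn_id
    | succ n ih =>
      rw [Function.iterate_succ']
      exact hfd.comp ih (hmaps n)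
  have hsum : DifferentiableOn ℂ (fun ζ => ∑' n : ℕ, (f (f^[n] ζ) - f^[n] ζ - β)) U := by
    refine Complex.differentiableOn_tsum_of_summable_norm
      (summable_geometric_exp hρ hε (K * Real.exp (-ε * R))) (fun n => ?_) hUo (fun n ζ hζ => ?_)
    · exact ((hfd.comp (hit n) (hmaps n)).sub (hit n)).sub_const _
    · refine (norm_term_le h hρ hε hK hg (hUR hζ) n).trans ?_
      have : R ≤ ζ.re := le_of_lt hζ.2
      have : -ε * ζ.re ≤ -ε * R := by nlinarith
      gcongr
  have : DifferentiableOn ℂ (linearization β f) U := differentiableOn_id.add hsum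
  exact (this.analyticOnNhd hUo).mono fun ζ hζ => ⟨hζ.1, hR.trans_le hζ.2⟩

end Linearization

/-! ### Exponential scales and expandable functions -/

/-- The comparison function `exp (-ν Re ζ)`. -/
def decay (ν : ℝ) (ζ : ℂ) : ℝ := Real.exp (-ν * ζ.re)

lemma decay_mul (μ ν : ℝ) : (fun ζ => decay μ ζ * decay ν ζ) = decay (μ + ν) := by
  ext ζ
  simp only [decay]
  rw [← Real.exp_add]; congr 1; ring

lemma decay_isLittleO {C μ ν : ℝ} (h : μ < ν) : decay ν =o[atInfty C] decay μ := by
  have : (fun x : ℝ => Real.exp (-ν * x)) =o[atTop] fun x => Real.exp (-μ * x) := by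
    rw [Real.isLittleO_exp_comp_exp_comp]
    have : (fun x : ℝ => -μ * x - -ν * x) = fun x => (ν - μ) * x := by ext; ring
    rw [this]
    exact tendsto_id.const_mul_atTop (by linarith)
  exact this.comp_tendsto (tendsto_re_atInfty C)

lemma decay_isBigO {C μ ν : ℝ} (h : μ ≤ ν) : decay ν =O[atInfty C] decay μ := by
  rcases h.eq_or_lt with rfl | h
  · exact isBigO_refl _ _
  · exact (decay_isLittleO h).isBigO

/-- On `R_C` the modulus of `ζ` is at most quadratic in `Re ζ`, so powers of `ζ` lose to every
exponential of `Re ζ`. -/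
lemma pow_isBigO_decay {C : ℝ} (hC : 0 < C) (m : ℕ) {ε : ℝ} (hε : 0 < ε) :
    (fun ζ : ℂ => ζ ^ m) =O[atInfty C] decay (-ε) := by
  obtain ⟨K, hK⟩ := norm_le_of_mem_quadDomain hC
  have h1 : (fun ζ : ℂ => ζ) =O[atInfty C] fun ζ : ℂ => ζ.re ^ 2 := by
    refine IsBigO.of_bound K ?_
    filter_upwards [eventually_mem_quadGerm C 0] with ζ hζ
    simpa using hK ζ hζ.1
  have h2 : (fun ζ : ℂ => (ζ.re ^ 2) ^ m) =O[atInfty C] decay (-ε) := by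
    have := (isLittleO_pow_exp_pos_mul_atTop (2 * m) hε).comp_tendsto (tendsto_re_atInfty C)
    refine (this.isBigO.congr (fun ζ => ?_) fun ζ => ?_)
    · simp [pow_mul]
    · simp [decay]
  exact (h1.pow m).trans h2

lemma norm_cexp_neg_mul (a : ℝ) (ζ : ℂ) : ‖Complex.exp (-((a : ℂ) * ζ))‖ = decay a ζ := by
  simp [Complex.norm_exp, decay]

lemma cexp_isBigO_decay {C : ℝ} (a : ℝ) :
    (fun ζ : ℂ => Complex.exp (-((a : ℂ) * ζ))) =O[atInfty C] decay a :=
  IsBigO.of_bound 1 (Eventually.of_forall fun ζ => by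
    rw [norm_cexp_neg_mul, one_mul]; exact le_abs_self _)

lemma isLittleO_cexp_iff {C ν : ℝ} {u : ℂ → ℂ} :
    (u =o[atInfty C] fun ζ => Complex.exp (-((ν : ℂ) * ζ))) ↔ u =o[atInfty C] decay ν := by
  rw [← isLittleO_norm_right]
  simp_rw [norm_cexp_neg_mul]

lemma poly_mul_cexp_isBigO {C : ℝ} (hC : 0 < C) (P : Polynomial ℂ) {a ν : ℝ} (h : ν < a) :
    (fun ζ : ℂ => P.eval ζ * Complex.exp (-((a : ℂ) * ζ))) =O[atInfty C] decay ν := by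
  have h1 : (fun ζ : ℂ => P.eval ζ) =O[atInfty C] decay (-(a - ν)) := by
    simp_rw [Polynomial.eval_eq_sum_range]
    exact IsBigO.fun_sum fun i _ => (pow_isBigO_decay hC i (sub_pos.2 h)).const_mul_left _
  have := h1.mul (cexp_isBigO_decay (C := C) a)
  rwa [decay_mul, neg_sub, sub_add_cancel] at this

lemma tendsto_zero_of_isBigO_decay {C ν : ℝ} (hν : 0 < ν) {u : ℂ → ℂ}
    (h : u =O[atInfty C] decay ν) : Tendsto u (atInfty C) (𝓝 0) :=
  h.trans_tendsto (Real.tendsto_exp_atBot.comp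
    ((tendsto_re_atInfty C).const_mul_atTop_of_neg (by linarith)))

/-- Finite sums of the functions `ζ ^ m * exp (-a ζ)` with exponents `a ≥ t` in `Γ`. -/
def expSums (Γ : AddSubmonoid ℝ) (t : ℝ) : Submodule ℂ (ℂ → ℂ) :=
  Submodule.span ℂ {u | ∃ (m : ℕ) (a : ℝ), a ∈ Γ ∧ t ≤ a ∧
    u = fun ζ => ζ ^ m * Complex.exp (-((a : ℂ) * ζ))}

/-- Functions on `R_C` that are approximated to every exponential order by sums in
`expSums Γ t`. -/
def expandable (C : ℝ) (Γ : AddSubmonoid ℝ) (t : ℝ) : Submodule ℂ (ℂ → ℂ) where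
  carrier := {u | ∀ ν : ℝ, ∃ v ∈ expSums Γ t, (u - v) =O[atInfty C] decay ν}
  add_mem' {u₁ u₂} h₁ h₂ ν := by
    obtain ⟨v₁, hv₁, e₁⟩ := h₁ ν
    obtain ⟨v₂, hv₂, e₂⟩ := h₂ ν
    exact ⟨v₁ + v₂, add_mem hv₁ hv₂, by rw [add_sub_add_comm]; exact e₁.add e₂⟩
  zero_mem' ν := ⟨0, zero_mem _, by rw [sub_zero]; exact isBigO_zero _ _⟩
  smul_mem' c u h ν := by
    obtain ⟨v, hv, e⟩ := h ν
    exact ⟨c • v, Submodule.smul_mem _ _ hv, by rw [← smul_sub]; exact e.const_smul_left c⟩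

variable {C : ℝ} {Γ : AddSubmonoid ℝ} {s t : ℝ}

lemma pow_mul_cexp_mem_expSums (m : ℕ) {a : ℝ} (ha : a ∈ Γ) (h : t ≤ a) :
    (fun ζ : ℂ => ζ ^ m * Complex.exp (-((a : ℂ) * ζ))) ∈ expSums Γ t :=
  Submodule.subset_span ⟨m, a, ha, h, rfl⟩

lemma poly_mul_cexp_mem_expSums (P : Polynomial ℂ) {a : ℝ} (ha : a ∈ Γ) (h : t ≤ a) :
    (fun ζ : ℂ => P.eval ζ * Complex.exp (-((a : ℂ) * ζ))) ∈ expSums Γ t := by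
  have : (fun ζ : ℂ => P.eval ζ * Complex.exp (-((a : ℂ) * ζ))) =
      ∑ i ∈ Finset.range (P.natDegree + 1), P.coeff i •
        fun ζ : ℂ => ζ ^ i * Complex.exp (-((a : ℂ) * ζ)) := by
    ext ζ
    simp [Polynomial.eval_eq_sum_range, Finset.sum_mul, mul_assoc]
  rw [this]
  exact Submodule.sum_mem _ fun i _ => Submodule.smul_mem _ _ (pow_mul_cexp_mem_expSums i ha h)

lemma expSums_anti (h : s ≤ t) : expSums Γ t ≤ expSums Γ s := by
  refine Submodule.span_mono ?_
  rintro _ ⟨m, a, ha, hta, rfl⟩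
  exact ⟨m, a, ha, h.trans hta, rfl⟩

lemma expSums_le_expandable : expSums Γ t ≤ expandable C Γ t :=
  fun u hu _ => ⟨u, hu, by rw [sub_self]; exact isBigO_zero _ _⟩

lemma expandable_anti (h : s ≤ t) : expandable C Γ t ≤ expandable C Γ s := by
  intro u hu ν
  obtain ⟨v, hv, e⟩ := hu ν
  exact ⟨v, expSums_anti h hv, e⟩

lemma mul_mem_expSums {u v : ℂ → ℂ} (hu : u ∈ expSums Γ s) (hv : v ∈ expSums Γ t) :
    u * v ∈ expSums Γ (s + t) := by
  have h := Submodule.mul_mem_mul hu hv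
  unfold expSums at h
  rw [Submodule.span_mul_span] at h
  refine Submodule.span_mono ?_ h
  rintro _ ⟨_, ⟨m, a, ha, hsa, rfl⟩, _, ⟨n, b, hb, htb, rfl⟩, rfl⟩
  refine ⟨m + n, a + b, add_mem ha hb, add_le_add hsa htb, ?_⟩
  ext ζ
  have : -(((a + b : ℝ) : ℂ) * ζ) = -((a : ℂ) * ζ) + -((b : ℂ) * ζ) := by push_cast; ring
  simp only [Pi.mul_apply]
  rw [this, Complex.exp_add, pow_add]
  ring

lemma expSums_isBigO (hC : 0 < C) {ν : ℝ} (h : ν < t) {u : ℂ → ℂ} (hu : u ∈ expSums Γ t) :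
    u =O[atInfty C] decay ν := by
  induction hu using Submodule.span_induction with
  | mem u hu =>
    obtain ⟨m, a, -, hta, rfl⟩ := hu
    have := poly_mul_cexp_isBigO hC (Polynomial.X ^ m) (h.trans_le hta)
    simpa using this
  | zero => exact isBigO_zero _ _
  | add u v _ _ hu hv => exact hu.add hv
  | smul c u _ hu => exact hu.const_smul_left c

lemma expandable_isBigO (hC : 0 < C) {ν : ℝ} (h : ν < t) {u : ℂ → ℂ}
    (hu : u ∈ expandable C Γ t) : u =O[atInfty C] decay ν := by
  obtain ⟨v, hv, e⟩ := hu ν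
  simpa using e.add (expSums_isBigO hC h hv)

lemma mul_mem_expandable (hC : 0 < C) {u v : ℂ → ℂ} (hu : u ∈ expandable C Γ s)
    (hv : v ∈ expandable C Γ t) : u * v ∈ expandable C Γ (s + t) := by
  intro ν
  -- From `uv - u'v' = (u - u')v + u'(v - v')`; the shifts by `t - 1` and `s - 1` account for the
  -- orders of `v` and `u'`, which may be growing.
  obtain ⟨u', hu', eu⟩ := hu (ν - (t - 1))
  obtain ⟨v', hv', ev⟩ := hv (ν - (s - 1))
  refine ⟨u' * v', mul_mem_expSums hu' hv', ?_⟩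
  have h1 := eu.mul (expandable_isBigO hC (by linarith : t - 1 < t) hv)
  have h2 := (expSums_isBigO hC (by linarith : s - 1 < s) hu').mul ev
  rw [decay_mul] at h1 h2
  rw [sub_add_cancel] at h1
  rw [add_sub_cancel] at h2
  refine (h1.add h2).congr_left fun ζ => ?_
  simp only [Pi.sub_apply, Pi.mul_apply]
  ring

lemma mem_expandable_of_approx {u : ℂ → ℂ}
    (h : ∀ ν : ℝ, ∃ v ∈ expandable C Γ t, (u - v) =O[atInfty C] decay ν) :
    u ∈ expandable C Γ t := by
  intro ν
  obtain ⟨v, hv, e⟩ := h ν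
  obtain ⟨w, hw, e'⟩ := hv ν
  exact ⟨w, hw, (e.add e').congr_left fun ζ => by simp⟩

lemma const_mem_expSums (c : ℂ) : (fun _ => c) ∈ expSums Γ 0 := by
  simpa using poly_mul_cexp_mem_expSums (Γ := Γ) (t := 0) (Polynomial.C c) Γ.zero_mem le_rfl

lemma id_mem_expSums : (fun ζ => ζ) ∈ expSums Γ 0 := by
  simpa using poly_mul_cexp_mem_expSums (Γ := Γ) (t := 0) Polynomial.X Γ.zero_mem le_rfl

lemma pow_mem_expandable (hC : 0 < C) {u : ℂ → ℂ} (hu : u ∈ expandable C Γ t) (n : ℕ) :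
    u ^ n ∈ expandable C Γ (n * t) := by
  induction n with
  | zero =>
    rw [pow_zero, Nat.cast_zero, zero_mul]
    exact expSums_le_expandable (C := C) (const_mem_expSums (Γ := Γ) 1)
  | succ n ih =>
    rw [pow_succ]
    rw [Nat.cast_succ, add_one_mul]
    exact mul_mem_expandable hC ih hu

lemma cexp_sub_one_mem_expandable (hC : 0 < C) (ht : 0 < t) {u : ℂ → ℂ}
    (hu : u ∈ expandable C Γ t) : (fun ζ => Complex.exp (u ζ) - 1) ∈ expandable C Γ t := by
  refine mem_expandable_of_approx fun ν => ?_
  -- Because of polynomial factors only `u = O(decay (t/2))` is used; the Taylor remainder of order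
  -- `J + 1` is then of order `(J + 1) t/2 ≥ ν`.
  obtain ⟨J, hJ⟩ := exists_nat_ge (ν / (t / 2))
  rw [div_le_iff₀ (by positivity)] at hJ
  refine ⟨∑ j ∈ Finset.range J, ((j + 1).factorial : ℂ)⁻¹ • u ^ (j + 1), ?_, ?_⟩
  · refine Submodule.sum_mem _ fun j _ => Submodule.smul_mem _ _ ?_
    refine expandable_anti ?_ (pow_mem_expandable hC hu (j + 1))
    push_cast
    nlinarith [(Nat.cast_nonneg j : (0 : ℝ) ≤ j)]
  · have hsmall := expandable_isBigO hC (by linarith : t / 2 < t) hu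
    have hu0 := tendsto_zero_of_isBigO_decay (by positivity) hsmall
    have h1 : (fun ζ => u ζ ^ (J + 1)) =O[atInfty C] decay ν := by
      refine (hsmall.pow (J + 1)).trans ?_
      have : (fun ζ => decay (t / 2) ζ ^ (J + 1)) = decay ((J + 1) * (t / 2)) := by
        ext ζ
        simp only [decay]
        rw [← Real.exp_nat_mul]
        congr 1; push_cast; ring
      rw [this]
      exact decay_isBigO (by nlinarith)
    refine IsBigO.trans ?_ h1
    refine IsBigO.of_bound (Real.exp 1) ?_
    filter_upwards [hu0.norm.eventually (gt_mem_nhds (by simp : ‖(0 : ℂ)‖ < 1))] with ζ hζ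
    have h2 := Complex.norm_exp_sub_sum_le_norm_mul_exp (u ζ) (J + 1)
    rw [Finset.sum_range_succ'] at h2
    have h3 : Real.exp ‖u ζ‖ ≤ Real.exp 1 := Real.exp_le_exp.2 hζ.le
    calc _ = ‖Complex.exp (u ζ) - (∑ k ∈ Finset.range J, u ζ ^ (k + 1) / ((k + 1).factorial : ℂ) +
          u ζ ^ 0 / (Nat.factorial 0 : ℂ))‖ := by
          congr 1
          simp only [Pi.sub_apply, Finset.sum_apply, Pi.smul_apply, Pi.pow_apply, smul_eq_mul,
            pow_zero, Nat.factorial_zero, Nat.cast_one, div_eq_inv_mul, mul_one, inv_one]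
          rw [sub_sub, add_comm (1 : ℂ)]
      _ ≤ ‖u ζ‖ ^ (J + 1) * Real.exp ‖u ζ‖ := h2
      _ ≤ Real.exp 1 * ‖u ζ ^ (J + 1)‖ := by
          rw [norm_pow, mul_comm]
          gcongr

/-! ### Formal linearization and its comparison with the true one -/

section Composition
variable {β : ℂ} {f : ℂ → ℂ} {δ : ℝ}

lemma pow_sub_pow_mem_expandable (hC : 0 < C) (hδ : 0 ≤ δ)
    (hf : (fun ζ => f ζ - ζ - β) ∈ expandable C Γ δ) (m : ℕ) :
    (fun ζ => f ζ ^ m - (ζ + β) ^ m) ∈ expandable C Γ δ := by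
  have hβ : (fun ζ => ζ + β) ∈ expandable C Γ 0 :=
    add_mem (expSums_le_expandable id_mem_expSums) (expSums_le_expandable (const_mem_expSums β))
  have hf0 : f ∈ expandable C Γ 0 := by
    convert add_mem (expandable_anti hδ hf) hβ using 1
    ext ζ; simp
  induction m with
  | zero =>
    convert (expandable C Γ δ).zero_mem using 1
    ext ζ; simp
  | succ m ih =>
    have h1 := mul_mem_expandable hC hf0 ih
    have h2 := mul_mem_expandable hC hf (pow_mem_expandable hC hβ m)
    simp only [mul_zero, add_zero, zero_add] at h1 h2
    convert add_mem h1 h2 using 1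
    ext ζ
    simp only [Pi.add_apply, Pi.mul_apply, Pi.pow_apply]
    ring

/-- Replacing the translation `ζ + β` by `f` in a sum of exponents at least `t` changes it by
terms of exponents at least `t + δ`. -/
lemma comp_sub_comp_mem_expandable (hC : 0 < C) (hδ : 0 < δ)
    (hf : (fun ζ => f ζ - ζ - β) ∈ expandable C Γ δ) {v : ℂ → ℂ} (hv : v ∈ expSums Γ t) :
    (fun ζ => v (f ζ) - v (ζ + β)) ∈ expandable C Γ (t + δ) := by
  induction hv using Submodule.span_induction with
  | mem u hu =>
    obtain ⟨m, a, ha, hta, rfl⟩ := hu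
    have hβ : (fun ζ => ζ + β) ∈ expandable C Γ 0 :=
      add_mem (expSums_le_expandable id_mem_expSums) (expSums_le_expandable (const_mem_expSums β))
    have hf0 : f ∈ expandable C Γ 0 := by
      convert add_mem (expandable_anti hδ.le hf) hβ using 1
      ext ζ; simp
    -- With `g = f - ζ - β`, the difference is `exp(-aβ) exp(-aζ) (f^m (exp(-ag) - 1) + f^m - (ζ +
    -- β)^m)`, and both summands in the bracket gain `δ`.
    have h1 := cexp_sub_one_mem_expandable hC hδ (Submodule.smul_mem _ (-(a : ℂ)) hf)
    have h2 := mul_mem_expandable hC (pow_mem_expandable hC hf0 m) h1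
    have h3 := pow_sub_pow_mem_expandable hC hδ.le hf m
    simp only [mul_zero, zero_add] at h2
    have h4 := mul_mem_expandable hC
      (expSums_le_expandable (C := C) (pow_mul_cexp_mem_expSums 0 ha hta)) (add_mem h2 h3)
    convert Submodule.smul_mem _ (Complex.exp (-((a : ℂ) * β))) h4 using 1
    ext ζ
    simp only [Pi.add_apply, Pi.mul_apply, Pi.pow_apply, Pi.smul_apply, smul_eq_mul, pow_zero,
      one_mul]
    have e1 : Complex.exp (-((a : ℂ) * f ζ)) = Complex.exp (-((a : ℂ) * β)) *
        Complex.exp (-((a : ℂ) * ζ)) * Complex.exp (-(a : ℂ) * (f ζ - ζ - β)) := by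
      rw [← Complex.exp_add, ← Complex.exp_add]; congr 1; ring
    have e2 : Complex.exp (-((a : ℂ) * (ζ + β))) = Complex.exp (-((a : ℂ) * β)) *
        Complex.exp (-((a : ℂ) * ζ)) := by
      rw [← Complex.exp_add]; congr 1; ring
    rw [e1, e2]
    ring
  | zero =>
    convert (expandable C Γ (t + δ)).zero_mem using 1
    ext ζ; simp
  | add u v _ _ hu hv =>
    convert add_mem hu hv using 1
    ext ζ; simp; ring
  | smul c u _ hu =>
    convert Submodule.smul_mem _ c hu using 1
    ext ζ; simp; ring

/-- The difference equation `v(ζ + β) - v(ζ) = w(ζ)` is solvable in exponential sums. -/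
lemma exists_difference_eq (hβ : 0 < β.re) (ht : 0 < t) {w : ℂ → ℂ} (hw : w ∈ expSums Γ t) :
    ∃ v ∈ expSums Γ t, ∀ ζ, v (ζ + β) - v ζ = w ζ := by
  induction hw using Submodule.span_induction with
  | mem u hu =>
    obtain ⟨m, a, ha, hta, rfl⟩ := hu
    -- Its modulus is `exp(-a Re β) < 1`: the positivity of `Re β` and `a` excludes resonances.
    have hlam : Complex.exp (-((a : ℂ) * β)) - 1 ≠ 0 := by
      intro h
      have h1 : ‖Complex.exp (-((a : ℂ) * β))‖ = 1 := by rw [sub_eq_zero.1 h]; simp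
      rw [norm_cexp_neg_mul, decay, Real.exp_eq_one_iff] at h1
      nlinarith
    set l := Complex.exp (-((a : ℂ) * β)) with hl
    induction m using Nat.strong_induction_on with
    | _ m ih =>
      choose! v hv hveq using ih
      -- The shift multiplies the top power by `l`; the lower powers from the binomial expansion are
      -- cancelled by the solutions `v j`.
      refine ⟨(l - 1)⁻¹ • ((fun ζ => ζ ^ m * Complex.exp (-((a : ℂ) * ζ))) -
        ∑ j ∈ Finset.range m, (l * (β ^ (m - j) * m.choose j)) • v j), ?_, fun ζ => ?_⟩
      · refine Submodule.smul_mem _ _ (sub_mem (pow_mul_cexp_mem_expSums m ha hta) ?_)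
        exact Submodule.sum_mem _ fun j hj => Submodule.smul_mem _ _ (hv j (Finset.mem_range.1 hj))
      · have e1 : Complex.exp (-((a : ℂ) * (ζ + β))) = l * Complex.exp (-((a : ℂ) * ζ)) := by
          rw [hl, ← Complex.exp_add]; congr 1; ring
        have e2 : (ζ + β) ^ m = ∑ j ∈ Finset.range m, ζ ^ j * β ^ (m - j) * m.choose j + ζ ^ m := by
          rw [add_pow, Finset.sum_range_succ]; simp
        have e3 : ∑ j ∈ Finset.range m, (l * (β ^ (m - j) * m.choose j)) * v j (ζ + β) -
            ∑ j ∈ Finset.range m, (l * (β ^ (m - j) * m.choose j)) * v j ζ =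
            l * Complex.exp (-((a : ℂ) * ζ)) *
              ∑ j ∈ Finset.range m, ζ ^ j * β ^ (m - j) * m.choose j := by
          rw [← Finset.sum_sub_distrib, Finset.mul_sum]
          refine Finset.sum_congr rfl fun j hj => ?_
          rw [← mul_sub, hveq j (Finset.mem_range.1 hj)]
          ring
        simp only [Pi.smul_apply, Pi.sub_apply, Finset.sum_apply, smul_eq_mul]
        rw [e1, e2]
        generalize ∑ j ∈ Finset.range m, (l * (β ^ (m - j) * m.choose j)) * v j (ζ + β) = S₁
          at e3 ⊢
        generalize ∑ j ∈ Finset.range m, (l * (β ^ (m - j) * m.choose j)) * v j ζ = S₂ at e3 ⊢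
        field_simp
        linear_combination -e3
  | zero => exact ⟨0, zero_mem _, by simp⟩
  | add u v _ _ hu hv =>
    obtain ⟨u', hu', eu⟩ := hu
    obtain ⟨v', hv', ev⟩ := hv
    exact ⟨u' + v', add_mem hu' hv', fun ζ => by
      simp only [Pi.add_apply]; linear_combination eu ζ + ev ζ⟩
  | smul c u _ hu =>
    obtain ⟨u', hu', eu⟩ := hu
    exact ⟨c • u', Submodule.smul_mem _ _ hu', fun ζ => by
      simp only [Pi.smul_apply, smul_eq_mul]; linear_combination c * eu ζ⟩

/-- Approximate linearization to any exponential order. -/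
lemma exists_approx_linearization (hC : 0 < C) (hβ : 0 < β.re) (hδ : 0 < δ)
    (hf : (fun ζ => f ζ - ζ - β) ∈ expandable C Γ δ) (ν : ℝ) :
    ∃ u ∈ expSums Γ δ, (fun ζ => f ζ + u (f ζ) - (ζ + u ζ) - β) =O[atInfty C] decay ν := by
  have key : ∀ k : ℕ, ∃ u ∈ expSums Γ δ, ∃ e ∈ expandable C Γ ((k + 1) * δ),
      ((fun ζ => f ζ + u (f ζ) - (ζ + u ζ) - β) - e) =O[atInfty C] decay ν := by
    intro k
    induction k with
    | zero =>
      refine ⟨0, zero_mem _, _, by simpa using hf, ?_⟩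
      refine (isBigO_zero _ _).congr_left fun ζ => ?_
      simp
    | succ k ih =>
      obtain ⟨u, hu, e, he, hue⟩ := ih
      obtain ⟨w, hw, hew⟩ := he ν
      obtain ⟨v, hv, hvw⟩ := exists_difference_eq hβ (by positivity) hw
      -- Subtracting `v` cancels the error `w` for the translation; using `f` instead leaves an
      -- error with exponents larger by `δ`.
      refine ⟨u - v, sub_mem hu (expSums_anti ?_ hv), -fun ζ => v (f ζ) - v (ζ + β), ?_, ?_⟩
      · nlinarith [(Nat.cast_nonneg k : (0 : ℝ) ≤ k)]
      · convert neg_mem (comp_sub_comp_mem_expandable hC hδ hf hv) using 3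
        push_cast; ring
      · refine (hue.add hew).congr_left fun ζ => ?_
        simp only [Pi.sub_apply, Pi.neg_apply]
        linear_combination hvw ζ
  obtain ⟨k, hk⟩ := exists_nat_gt (ν / δ)
  rw [div_lt_iff₀ hδ] at hk
  obtain ⟨u, hu, e, he, hue⟩ := key k
  refine ⟨u, hu, ?_⟩
  have := hue.add (expandable_isBigO hC (by nlinarith : ν < (k + 1) * δ) he)
  simpa using this

/-- A linearizing map tangent to the identity has an expansion. -/
lemma sub_id_mem_expandable (hC : 0 < C) (hβ : 0 < β.re) (hδ : 0 < δ)
    (hf : (fun ζ => f ζ - ζ - β) ∈ expandable C Γ δ) {R ρ : ℝ} (hp : Pushes C R ρ f) (hρ : 0 < ρ)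
    {φ : ℂ → ℂ} (hφ : Tendsto (fun ζ => φ ζ - ζ) (atInfty C) (𝓝 0))
    (hφf : ∀ ζ ∈ quadGerm C R, φ (f ζ) = φ ζ + β) :
    (fun ζ => φ ζ - ζ) ∈ expandable C Γ δ := by
  have key : ∀ ν : ℝ, 0 < ν → ∃ u ∈ expSums Γ δ,
      ((fun ζ => φ ζ - ζ) - u) =O[atInfty C] decay ν := by
    intro ν hν
    obtain ⟨u, hu, e⟩ := exists_approx_linearization hC hβ hδ hf ν
    refine ⟨u, hu, ?_⟩
    obtain ⟨K, hK, hKe⟩ := e.exists_nonneg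
    obtain ⟨R', hR'⟩ := eventually_atInfty_iff.1 hKe.bound
    have hu0 := tendsto_zero_of_isBigO_decay (by positivity)
      (expSums_isBigO hC (by linarith : δ / 2 < δ) hu)
    -- The coboundary of `φ - id - u` is minus the linearization error of `id + u`, since `φ`
    -- linearizes exactly.
    have hr : Tendsto ((fun ζ => φ ζ - ζ) - u) (atInfty C) (𝓝 0) := by
      rw [← sub_zero (0 : ℂ)]
      exact hφ.sub hu0
    refine IsBigO.of_bound (K / (1 - Real.exp (-ν * ρ)))
      (eventually_atInfty_iff.2 ⟨max R R', fun ζ hζ => ?_⟩)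
    refine ((hp.mono (le_max_left R R')).norm_le_of_coboundary hρ hν hK hr (fun ζ hζ => ?_)
      ζ hζ).trans (mul_le_mul_of_nonneg_left (le_abs_self _) ?_)
    · have h1 := hR' ζ (quadGerm_anti (le_max_right _ _) hζ)
      rw [decay, Real.norm_eq_abs, Real.abs_exp, ← norm_neg] at h1
      refine (congrArg norm ?_).trans_le h1
      rw [Pi.sub_apply, Pi.sub_apply, hφf ζ (quadGerm_anti (le_max_left _ _) hζ)]
      ring
    · refine div_nonneg hK (sub_nonneg.2 (Real.exp_le_one_iff.2 (by nlinarith)))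
  intro ν
  -- The coboundary estimate needs a positive order; smaller orders follow.
  obtain ⟨u, hu, e⟩ := key (max ν 1) (by positivity)
  exact ⟨u, hu, e.trans (decay_isBigO (le_max_left _ _))⟩

end Composition

/-! ### Independence of exponentials and passage to Dulac series -/

lemma polynomial_eq_zero_of_tendsto {P : Polynomial ℂ}
    (h : Tendsto (fun x : ℝ => P.eval (x : ℂ)) atTop (𝓝 0)) : P = 0 := by
  by_cases hd : 0 < P.degree
  · have h1 : Tendsto (fun x : ℝ => ‖(x : ℂ)‖) atTop atTop := by
      simpa using tendsto_abs_atTop_atTop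
    exact absurd h.norm (not_tendsto_nhds_of_tendsto_atTop (P.tendsto_norm_atTop hd h1) _)
  · rw [Polynomial.eq_C_of_degree_le_zero (not_lt.1 hd)] at h ⊢
    simp only [Polynomial.eval_C] at h
    rw [tendsto_nhds_unique tendsto_const_nhds h, Polynomial.C_0]

/-- The function `∑ Pₐ(ζ) exp(-a ζ)` of a finitely supported family of polynomials. -/
def evalSum : (ℝ →₀ Polynomial ℂ) →ₗ[ℂ] (ℂ → ℂ) :=
  Finsupp.lsum ℂ fun a : ℝ =>
    { toFun := fun P ζ => P.eval ζ * Complex.exp (-((a : ℂ) * ζ))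
      map_add' := fun P Q => by ext ζ; simp [add_mul]
      map_smul' := fun c P => by ext ζ; simp [mul_assoc] }

lemma evalSum_apply (p : ℝ →₀ Polynomial ℂ) (ζ : ℂ) :
    evalSum p ζ = ∑ a ∈ p.support, (p a).eval ζ * Complex.exp (-((a : ℂ) * ζ)) := by
  simp [evalSum, Finsupp.sum]

lemma exists_evalSum_eq {Γ : AddSubmonoid ℝ} {t : ℝ} {u : ℂ → ℂ} (hu : u ∈ expSums Γ t) :
    ∃ p : ℝ →₀ Polynomial ℂ, (∀ a, p a ≠ 0 → a ∈ Γ ∧ t ≤ a) ∧ evalSum p = u := by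
  classical
  induction hu using Submodule.span_induction with
  | mem u hu =>
    obtain ⟨m, a, ha, hta, rfl⟩ := hu
    refine ⟨Finsupp.single a (Polynomial.X ^ m), fun b hb => ?_, ?_⟩
    · rw [Finsupp.single_apply] at hb
      split_ifs at hb with hab
      · exact hab ▸ ⟨ha, hta⟩
      · exact absurd rfl hb
    · ext ζ
      rw [evalSum, Finsupp.lsum_single]
      simp
  | zero => exact ⟨0, by simp, map_zero _⟩
  | add u v _ _ hu hv =>
    obtain ⟨p, hp, rfl⟩ := hu
    obtain ⟨q, hq, rfl⟩ := hv
    refine ⟨p + q, fun a ha => ?_, map_add _ _ _⟩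
    by_cases h : p a = 0
    · exact hq a fun h' => ha (by simp [h, h'])
    · exact hp a h
  | smul c u _ hu =>
    obtain ⟨p, hp, rfl⟩ := hu
    exact ⟨c • p, fun a ha => hp a fun h => ha (by simp [h]), map_smul _ _ _⟩

/-- Distinct exponentials with polynomial coefficients are asymptotically independent. -/
lemma eq_zero_of_evalSum_isBigO {C : ℝ} (hC : 0 < C) {p : ℝ →₀ Polynomial ℂ} {ν : ℝ}
    (h : evalSum p =O[atInfty C] decay ν) {a : ℝ} (ha : a < ν) : p a = 0 := by
  by_contra hpa
  have hne : p.support.Nonempty := ⟨a, Finsupp.mem_support_iff.2 hpa⟩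
  -- After multiplication by `exp(bζ)` for the smallest exponent `b`, all other terms vanish at
  -- infinity, so the polynomial at `b` tends to `0` on the reals.
  set b := p.support.min' hne with hb
  have hbmem : b ∈ p.support := p.support.min'_mem hne
  have hbν : b < ν := (p.support.min'_le a (Finsupp.mem_support_iff.2 hpa)).trans_lt ha
  refine Finsupp.mem_support_iff.1 hbmem (polynomial_eq_zero_of_tendsto ?_)
  have h1 : (fun ζ => ∑ x ∈ p.support.erase b,
      (p x).eval ζ * Complex.exp (-((x : ℂ) * ζ))) =o[atInfty C] decay b := by
    refine IsLittleO.fun_sum fun x hx => ?_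
    have hbx : b < x := lt_of_le_of_ne (p.support.min'_le x (Finset.mem_of_mem_erase hx))
      (Finset.ne_of_mem_erase hx).symm
    exact (poly_mul_cexp_isBigO hC (p x) (by linarith : (b + x) / 2 < x)).trans_isLittleO
      (decay_isLittleO (by linarith))
  have h2 : (fun ζ => (p b).eval ζ * Complex.exp (-((b : ℂ) * ζ))) =o[atInfty C] decay b := by
    refine ((h.trans_isLittleO (decay_isLittleO hbν)).sub h1).congr_left fun ζ => ?_
    rw [evalSum_apply, ← Finset.add_sum_erase _ _ hbmem, add_sub_cancel_right]
  have h3 := (cexp_isBigO_decay (C := C) (-b)).mul_isLittleO h2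
  rw [decay_mul, neg_add_cancel] at h3
  have h4 : (fun ζ => (p b).eval ζ) =o[atInfty C] fun _ => (1 : ℝ) := by
    refine h3.congr (fun ζ => ?_) fun ζ => by simp [decay]
    rw [mul_left_comm, ← Complex.exp_add]
    simp
  rw [isLittleO_one_iff] at h4
  exact h4.comp (tendsto_ofReal_atInfty hC)

/-- Expandable functions use the exponent `0` for polynomials, hence a monoid; Dulac series ask for
a semigroup, which differs only in `0`. -/
lemma pos_mem_closure {s : Finset ℝ} {x : ℝ} (hx : x ∈ AddSubmonoid.closure (s : Set ℝ))
    (h0 : 0 < x) : x ∈ AddSubsemigroup.closure (s : Set ℝ) := by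
  have : x = 0 ∨ x ∈ AddSubsemigroup.closure (s : Set ℝ) := by
    clear h0
    induction hx using AddSubmonoid.closure_induction with
    | mem x hx => exact Or.inr (AddSubsemigroup.subset_closure hx)
    | zero => exact Or.inl rfl
    | add x y _ _ hx hy =>
      rcases hx with rfl | hx
      · simpa using hy
      · rcases hy with rfl | hy
        · simpa using Or.inr hx
        · exact Or.inr (add_mem hx hy)
  exact this.resolve_left h0.ne'

lemma mem_addSubmonoid_closure (s : Finset ℝ) {x : ℝ}
    (hx : x ∈ AddSubsemigroup.closure (s : Set ℝ)) : x ∈ AddSubmonoid.closure (s : Set ℝ) := by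
  induction hx using AddSubsemigroup.closure_induction with
  | mem x hx => exact AddSubmonoid.subset_closure hx
  | add x y _ _ hx hy => exact add_mem hx hy

/-- The generators are positive, so the coefficient of `x` in an element at most `M` is at most `M /
x`. -/
lemma finite_closure_inter_Iic {s : Finset ℝ} (hs : ∀ x ∈ s, 0 < x) (M : ℝ) :
    ((AddSubmonoid.closure (s : Set ℝ) : Set ℝ) ∩ Set.Iic M).Finite := by
  classical
  choose! k hk using fun x : ℝ => exists_nat_gt (M / x)
  refine ((Fintype.piFinset fun x : s => Finset.range (k x)).finite_toSet.image
    fun g => ∑ x : s, g x • (x : ℝ)).subset ?_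
  rintro x ⟨hx, hxM⟩
  obtain ⟨g, -, rfl⟩ := AddSubmonoid.mem_closure_finset.1 hx
  refine ⟨fun x => g x, ?_, Finset.sum_coe_sort s fun x => g x • x⟩
  simp only [Finset.mem_coe, Fintype.mem_piFinset, Finset.mem_range]
  rintro ⟨y, hy⟩
  have h1 : g y • y ≤ ∑ a ∈ s, g a • a :=
    Finset.single_le_sum (f := fun a => g a • a) (fun a ha => nsmul_nonneg (hs a ha).le _) hy
  have h2 : (g y : ℝ) * y ≤ M := by
    rw [← nsmul_eq_mul]; exact h1.trans hxM
  have h3 := ((le_div_iff₀ (hs y hy)).2 h2).trans_lt (hk y)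
  exact_mod_cast h3

/-- An unbounded set of reals with finite initial segments is enumerated increasingly. -/
lemma exists_strictMono_range_eq {T : Set ℝ} (hfin : ∀ M, (T ∩ Set.Iic M).Finite)
    (hT : ∀ M, ∃ x ∈ T, M < x) :
    ∃ a : ℕ → ℝ, StrictMono a ∧ Tendsto a atTop atTop ∧ Set.range a = T := by
  obtain ⟨x₀, hx₀, -⟩ := hT 0
  obtain ⟨m, ⟨hmT, hmx⟩, hm⟩ :=
    Set.exists_min_image (T ∩ Set.Iic x₀) id (hfin x₀) ⟨x₀, hx₀, le_refl x₀⟩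
  -- A locally finite linear order with a least and no greatest element is isomorphic to `ℕ`.
  let : LocallyFiniteOrder T := LocallyFiniteOrder.ofFiniteIcc fun x y => by
    refine Set.Finite.of_finite_image (f := Subtype.val) ?_ Subtype.val_injective.injOn
    refine (hfin y).subset ?_
    rintro _ ⟨z, hz, rfl⟩
    exact ⟨z.2, hz.2⟩
  let : OrderBot T :=
    { bot := ⟨m, hmT⟩
      bot_le := fun x => by
        by_cases h : (x : ℝ) ≤ x₀
        · exact hm x ⟨x.2, h⟩
        · exact (show m ≤ x₀ from hmx).trans (not_le.1 h).le }
  have : NoMaxOrder T := ⟨fun x => by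
    obtain ⟨y, hy, hxy⟩ := hT x
    exact ⟨⟨y, hy⟩, hxy⟩⟩
  let : SuccOrder T := LinearLocallyFiniteOrder.succOrder T
  let : PredOrder T := LinearLocallyFiniteOrder.predOrder T
  let e : T ≃o ℕ := orderIsoNatOfLinearSuccPredArch
  have hmono : StrictMono fun n => (e.symm n : ℝ) := fun i j hij => e.symm.strictMono hij
  refine ⟨fun n => e.symm n, hmono, ?_, ?_⟩
  · refine tendsto_atTop_atTop_of_monotone hmono.monotone fun M => ?_
    obtain ⟨x, hx, hMx⟩ := hT M
    exact ⟨e ⟨x, hx⟩, by simpa using hMx.le⟩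
  · ext x
    exact ⟨fun ⟨n, hn⟩ => hn ▸ (e.symm n).2, fun hx => ⟨e ⟨x, hx⟩, by simp⟩⟩

/-- A map that differs from the identity by an expandable function has a parabolic Dulac
expansion. -/
theorem exists_series_of_mem_expandable {C : ℝ} (hC : 0 < C) {s : Finset ℝ}
    (hs : ∀ x ∈ s, 0 < x) {δ : ℝ} (hδ : 0 < δ) (hδs : δ ∈ AddSubmonoid.closure (s : Set ℝ))
    {φ : ℂ → ℂ}
    (hφ : (fun ζ => φ ζ - ζ) ∈ expandable C (AddSubmonoid.closure (s : Set ℝ)) δ) :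
    ∃ S : Series, S.IsParabolic ∧ HasExpansion C φ S := by
  set Γ := AddSubmonoid.closure (s : Set ℝ) with hΓ
  -- All positive elements of `Γ` serve as exponents, with zero polynomials where needed; the
  -- multiples of `δ` make them unbounded.
  obtain ⟨a, ha, hatop, harange⟩ := exists_strictMono_range_eq (T := {x | x ∈ Γ ∧ 0 < x})
    (fun M => (finite_closure_inter_Iic hs M).subset fun x hx => ⟨hx.1.1, hx.2⟩)
    (fun M => by
      obtain ⟨n, hn⟩ := exists_nat_gt (max M 0 / δ)
      rw [div_lt_iff₀ hδ] at hn
      refine ⟨n • δ, ⟨nsmul_mem hδs n, ?_⟩, ?_⟩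
      · rw [nsmul_eq_mul]; exact (le_max_right M 0).trans_lt hn
      · rw [nsmul_eq_mul]; exact (le_max_left M 0).trans_lt hn)
  have hamem : ∀ i, a i ∈ Γ ∧ 0 < a i := fun i => harange.subset ⟨i, rfl⟩
  have hp : ∀ n : ℕ, ∃ p : ℝ →₀ Polynomial ℂ, (∀ x, p x ≠ 0 → x ∈ Γ ∧ δ ≤ x) ∧
      ((fun ζ => φ ζ - ζ) - evalSum p) =O[atInfty C] decay n := by
    intro n
    obtain ⟨v, hv, e⟩ := hφ n
    obtain ⟨p, hp, rfl⟩ := exists_evalSum_eq hv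
    exact ⟨p, hp, e⟩
  choose p hpΓ hpO using hp
  -- Approximations were chosen separately for each order; independence makes two of them agree
  -- below the smaller order.
  have hcoh : ∀ {n m : ℕ} {x : ℝ}, x < n → n ≤ m → p n x = p m x := by
    intro n m x hx hnm
    have h1 : evalSum (p m - p n) =O[atInfty C] decay n := by
      refine ((hpO n).sub ((hpO m).trans (decay_isBigO (Nat.cast_le.2 hnm)))).congr_left
        fun ζ => ?_
      simp
    have := eq_zero_of_evalSum_isBigO hC h1 hx
    rw [Finsupp.sub_apply, sub_eq_zero] at this
    exact this.symm
  -- `⌊a i⌋₊ + 1` is the first order above `a i`; all later orders give the same polynomial.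
  refine ⟨⟨1, 0, fun i => p (⌊a i⌋₊ + 1) (a i), a, one_pos, fun i => (hamem i).2, ha, hatop,
    s, hs, fun i => pos_mem_closure (hamem i).1 (hamem i).2⟩, ⟨rfl, rfl⟩, fun ν _ => ?_⟩
  obtain ⟨n, hn⟩ := exists_nat_gt ν
  obtain ⟨N, hN⟩ : ∃ N : ℕ, ∀ i, i < N ↔ a i < n := by
    have hex : ∃ N, (n : ℝ) ≤ a N := (hatop.eventually_ge_atTop _).exists
    classical
    refine ⟨Nat.find hex, fun i => ⟨fun h => not_le.1 (Nat.find_min hex h), fun h => ?_⟩⟩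
    by_contra! hi
    exact absurd ((Nat.find_spec hex).trans (ha.monotone hi)) (not_le.2 h)
  refine ⟨N, isLittleO_cexp_iff.2 ?_⟩
  -- Exponents at least `n > ν` are negligible; the midpoint `(ν + n)/2` leaves room for the
  -- polynomial factors.
  have htail : (fun ζ => ∑ x ∈ (p n).support with ¬ x < (n : ℝ),
      ((p n) x).eval ζ * Complex.exp (-((x : ℂ) * ζ))) =O[atInfty C] decay ((ν + n) / 2) := by
    refine IsBigO.fun_sum fun x hx => poly_mul_cexp_isBigO hC _ ?_
    have := not_lt.1 (Finset.mem_filter.1 hx).2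
    linarith
  have hhead : ∀ ζ : ℂ, ∑ x ∈ (p n).support with x < (n : ℝ),
      ((p n) x).eval ζ * Complex.exp (-((x : ℂ) * ζ)) =
      ∑ i ∈ Finset.range N, (p (⌊a i⌋₊ + 1) (a i)).eval ζ * Complex.exp (-((a i : ℂ) * ζ)) := by
    intro ζ
    classical
    have h1 : ∑ i ∈ Finset.range N,
        (p (⌊a i⌋₊ + 1) (a i)).eval ζ * Complex.exp (-((a i : ℂ) * ζ)) =
        ∑ x ∈ (Finset.range N).image a, ((p n) x).eval ζ * Complex.exp (-((x : ℂ) * ζ)) := by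
      rw [Finset.sum_image ha.injective.injOn]
      refine Finset.sum_congr rfl fun i hi => ?_
      have hi := (hN i).1 (Finset.mem_range.1 hi)
      have hfl : ⌊a i⌋₊ + 1 ≤ n := (Nat.floor_lt (hamem i).2.le).2 hi
      rw [hcoh (by exact_mod_cast Nat.lt_floor_add_one (a i)) hfl]
    rw [h1]
    refine Finset.sum_subset (fun x hx => ?_) (fun x hx hx' => ?_)
    · obtain ⟨hx1, hx2⟩ := Finset.mem_filter.1 hx
      obtain ⟨h3, h4⟩ := hpΓ n x (Finsupp.mem_support_iff.1 hx1)
      obtain ⟨i, rfl⟩ : x ∈ Set.range a := harange.symm.subset ⟨h3, hδ.trans_le h4⟩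
      exact Finset.mem_image_of_mem _ (Finset.mem_range.2 ((hN i).2 hx2))
    · obtain ⟨i, hi, rfl⟩ := Finset.mem_image.1 hx
      have h0 : (p n) (a i) = 0 := by
        by_contra h
        exact hx' (Finset.mem_filter.2
          ⟨Finsupp.mem_support_iff.2 h, (hN i).1 (Finset.mem_range.1 hi)⟩)
      rw [h0, Polynomial.eval_zero, zero_mul]
  refine (((hpO n).trans (decay_isBigO (by linarith : (ν + n) / 2 ≤ n))).add htail
    |>.trans_isLittleO (decay_isLittleO (by linarith))).congr_left fun ζ => ?_
  rw [Pi.sub_apply, evalSum_apply, ← Finset.sum_filter_add_sum_filter_not _ (· < (n : ℝ)),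
    hhead, Series.partialSum]
  simp only [Complex.ofReal_one, one_mul, add_zero]
  ring

/-- A germ asymptotic to `ζ + β` with a Dulac expansion differs from `ζ + β` by an expandable
function. -/
lemma HasExpansion.sub_mem_expandable {C : ℝ} (hC : 0 < C) {f : ℂ → ℂ} {S : Series} {β : ℂ}
    (hS : HasExpansion C f S) (hf : Tendsto (fun ζ => f ζ - ζ - β) (atInfty C) (𝓝 0))
    {Γ : AddSubmonoid ℝ} (hΓ : ∀ i, S.a i ∈ Γ) :
    (fun ζ => f ζ - ζ - β) ∈ expandable C Γ (S.a 0) := by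
  have hsum : ∀ N, (fun ζ => ∑ i ∈ Finset.range N,
      (S.P i).eval ζ * Complex.exp (-((S.a i : ℂ) * ζ))) ∈ expSums Γ (S.a 0) := by
    intro N
    convert Submodule.sum_mem _ fun i (_ : i ∈ Finset.range N) =>
      poly_mul_cexp_mem_expSums (S.P i) (hΓ i) (S.a_strictMono.monotone (Nat.zero_le i)) using 1
    ext ζ; simp
  -- On the real axis the polynomial `(α - 1)x + (S.β - β)` tends to `0`, hence vanishes.
  have hlead : S.α = 1 ∧ S.β = β := by
    obtain ⟨N, hN⟩ := hS 1 one_pos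
    have h1 := tendsto_zero_of_isBigO_decay one_pos (isLittleO_cexp_iff.1 hN).isBigO
    have h2 := tendsto_zero_of_isBigO_decay (half_pos (S.a_pos 0))
      (expSums_isBigO hC (half_lt_self (S.a_pos 0)) (hsum N))
    have h3 := ((hf.sub h1).sub h2).comp (tendsto_ofReal_atInfty hC)
    have h4 := polynomial_eq_zero_of_tendsto
      (P := Polynomial.C ((S.α : ℂ) - 1) * Polynomial.X + Polynomial.C (S.β - β)) (by
        convert h3 using 1
        · ext x
          simp [Series.partialSum]
          ring
        · simp)
    have c0 := congrArg (fun P => Polynomial.coeff P 0) h4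
    have c1 := congrArg (fun P => Polynomial.coeff P 1) h4
    simp only [Polynomial.coeff_add, Polynomial.coeff_C_mul, Polynomial.coeff_X_zero, mul_zero,
      Polynomial.coeff_C_zero, zero_add, Polynomial.coeff_zero, Polynomial.coeff_X_one, mul_one,
      Polynomial.coeff_C_succ, add_zero] at c0 c1
    exact ⟨by exact_mod_cast sub_eq_zero.1 c1, sub_eq_zero.1 c0⟩
  have key : ∀ ν : ℝ, 0 < ν → ∃ v ∈ expSums Γ (S.a 0),
      ((fun ζ => f ζ - ζ - β) - v) =O[atInfty C] decay ν := by
    intro ν hν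
    obtain ⟨N, hN⟩ := hS ν hν
    refine ⟨_, hsum N, (isLittleO_cexp_iff.1 hN).isBigO.congr_left fun ζ => ?_⟩
    simp only [Series.partialSum, hlead.1, hlead.2, Pi.sub_apply, Complex.ofReal_one]
    ring
  intro ν
  obtain ⟨v, hv, e⟩ := key (max ν 1) (by positivity)
  exact ⟨v, hv, e.trans (decay_isBigO (le_max_left _ _))⟩

/-! ### Rigidity of maps of finite order -/

/-- A finite orbit of `ζ + h(ζ)` that closes up consists of a zero of `h`, if `h` has a small
Lipschitz constant. -/
lemma eq_zero_of_iterate_eq_self {φ : ℂ → ℂ} {B : Set ℂ} {q : ℕ} (hq : 1 ≤ q) {ζ : ℂ}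
    (hLip : ∀ z ∈ B, ‖(φ z - z) - (φ ζ - ζ)‖ ≤ 1 / (4 * q) * ‖z - ζ‖)
    (hB : ∀ z, ‖z - ζ‖ ≤ 2 * q * ‖φ ζ - ζ‖ → z ∈ B) (hφ : φ^[q] ζ = ζ) : φ ζ = ζ := by
  have hq0 : (0 : ℝ) < q := by exact_mod_cast hq
  set d := φ ζ - ζ with hd
  -- Each step of the orbit differs from `d` by at most `‖d‖/2`, so `q` steps cannot sum to zero
  -- unless `d = 0`.
  have key : ∀ j ≤ q, ‖φ^[j] ζ - ζ - j * d‖ ≤ j / 2 * ‖d‖ := by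
    intro j
    induction j with
    | zero => simp
    | succ j ih =>
      intro hj
      have ih := ih (by omega)
      have hjq : (j : ℝ) ≤ q := by exact_mod_cast (by omega : j ≤ q)
      have h1 : ‖φ^[j] ζ - ζ‖ ≤ 2 * q * ‖d‖ := by
        have h2 := norm_le_norm_sub_add (φ^[j] ζ - ζ) (j * d)
        rw [norm_mul, Complex.norm_natCast] at h2
        nlinarith [norm_nonneg d]
      have h3 := hLip _ (hB _ h1)
      have h4 : 1 / (4 * q) * ‖φ^[j] ζ - ζ‖ ≤ 1 / 2 * ‖d‖ := by
        calc 1 / (4 * q) * ‖φ^[j] ζ - ζ‖ ≤ 1 / (4 * q) * (2 * q * ‖d‖) := by gcongr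
          _ = 1 / 2 * ‖d‖ := by field_simp; ring
      rw [Function.iterate_succ_apply']
      have h5 : φ (φ^[j] ζ) - ζ - ((j + 1 : ℕ) : ℂ) * d =
          (φ^[j] ζ - ζ - j * d) + ((φ (φ^[j] ζ) - φ^[j] ζ) - d) := by push_cast; ring
      rw [h5]
      refine (norm_add_le _ _).trans ?_
      push_cast
      linarith
  have h := key q le_rfl
  rw [hφ, sub_self, zero_sub, norm_neg, norm_mul, Complex.norm_natCast] at h
  have : ‖d‖ ≤ 0 := by
    by_contra! hpos
    nlinarith [mul_pos hq0 hpos]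
  exact sub_eq_zero.1 (norm_le_zero_iff.1 this)

/-- Discs of fixed radius around far real points lie in `R_C`. -/
lemma exists_closedBall_subset {C : ℝ} (hC : 0 < C) (r : ℝ) (p : ℂ → Prop)
    (hp : ∀ᶠ ζ in atInfty C, p ζ) :
    ∃ X : ℝ, ∀ x : ℝ, X ≤ x → ∀ z : ℂ, ‖z - x‖ ≤ r → p z := by
  obtain ⟨R, hR⟩ := eventually_atInfty_iff.1 hp
  obtain ⟨R', hR'⟩ := exists_forall_add_mem_quadDomain hC (p := 1) (M := |r|) one_pos
  refine ⟨max (max R R') C + |r| + 2, fun x hx z hz => hR z ⟨?_, ?_⟩⟩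
  · have hmax1 := le_max_left (max R R') C
    have hmax2 := le_max_right (max R R') C
    have hmax3 := le_max_right R R'
    have h := hR' ((x - |r| - 1 : ℝ) : ℂ)
      ⟨ofReal_mem_quadDomain hC (by linarith), ?_⟩ (z - x + (|r| + 1 : ℝ)) ?_ ?_
    · convert h using 1
      push_cast; ring
    · show R' ≤ (((x - |r| - 1 : ℝ) : ℂ)).re
      rw [Complex.ofReal_re]; linarith
    · have := (abs_le.1 ((Complex.abs_re_le_norm _).trans (hz.trans (le_abs_self r)))).1
      rw [Complex.add_re, Complex.ofReal_re]; linarith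
    · have := (Complex.abs_im_le_norm _).trans (hz.trans (le_abs_self r))
      simpa using this
  · have := (abs_le.1 ((Complex.abs_re_le_norm _).trans (hz.trans (le_abs_self r)))).1
    have hmax1 := le_max_left (max R R') C
    have hmax3 := le_max_left R R'
    rw [Complex.sub_re, Complex.ofReal_re] at this
    show R ≤ z.re
    linarith

/-- A holomorphic germ tangent to the identity with an iterate equal to the identity is the
identity. -/
lemma eqOn_id_of_not_noIterateIsId {C R : ℝ} (hC : 0 < C) {φ : ℂ → ℂ}
    (hφ : AnalyticOnNhd ℂ φ (quadGerm C R))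
    (htan : Tendsto (fun ζ => φ ζ - ζ) (atInfty C) (𝓝 0)) (h : ¬ NoIterateIsId C R φ) :
    Set.EqOn φ id (quadGerm C R) := by
  unfold NoIterateIsId at h
  push Not at h
  obtain ⟨q, hq, R', hR'⟩ := h
  have hq0 : (0 : ℝ) < q := by exact_mod_cast hq
  -- The Lipschitz constant allowed by `eq_zero_of_iterate_eq_self`; also `q` steps of size `η` move
  -- a point by at most `1/4`, so orbits stay in the disc of radius `4`.
  set η : ℝ := 1 / (4 * q) with hη
  have hη0 : 0 < η := by positivity
  have hηq : 2 * q * η = 1 / 2 := by rw [hη]; field_simp; norm_num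
  have hη1 : η ≤ 1 := by
    have : (1 : ℝ) ≤ q := by exact_mod_cast hq
    rw [hη, div_le_one (by positivity)]; linarith
  obtain ⟨X, hX⟩ := exists_closedBall_subset hC 4
    (fun ζ => ζ ∈ quadGerm C R ∧ ζ ∈ quadGerm C R' ∧ ‖φ ζ - ζ‖ ≤ η)
    ((eventually_mem_quadGerm C R).and ((eventually_mem_quadGerm C R').and
      ((htan.norm.eventually (gt_mem_nhds (by simpa using hη0))).mono fun _ h => le_of_lt h)))
  have hball : ∀ z : ℂ, ‖z - X‖ ≤ 4 → z ∈ quadGerm C R ∧ z ∈ quadGerm C R' ∧ ‖φ z - z‖ ≤ η :=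
    hX X le_rfl
  have hdiff : ∀ z : ℂ, ‖z - X‖ ≤ 4 → DifferentiableAt ℂ (fun z => φ z - z) z := fun z hz =>
    (hφ z (hball z hz).1).differentiableAt.sub differentiableAt_id
  -- Cauchy's estimate on unit discs turns the bound `η` on radius `4` into a derivative bound on
  -- radius `3`.
  have hderiv : ∀ z ∈ Metric.closedBall (X : ℂ) 3, ‖deriv (fun z => φ z - z) z‖ ≤ η := by
    intro z hz
    rw [mem_closedBall_iff_norm] at hz
    have hsub : ∀ w ∈ Metric.closedBall z 1, ‖w - X‖ ≤ 4 := fun w hw => by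
      rw [mem_closedBall_iff_norm] at hw
      calc ‖w - X‖ ≤ ‖w - z‖ + ‖z - X‖ := norm_sub_le_norm_sub_add_norm_sub _ _ _
        _ ≤ 4 := by linarith
    have hd : DiffContOnCl ℂ (fun z => φ z - z) (Metric.ball z 1) := by
      apply DifferentiableOn.diffContOnCl
      rw [closure_ball _ one_ne_zero]
      exact fun w hw => (hdiff w (hsub w hw)).differentiableWithinAt
    have := Complex.norm_deriv_le_of_forall_mem_sphere_norm_le one_pos hd
      fun w hw => (hball w (hsub w (Metric.sphere_subset_closedBall hw))).2.2
    simpa using this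
  have hzero : ∀ ζ ∈ Metric.ball (X : ℂ) 1, φ ζ = ζ := by
    intro ζ hζ
    rw [mem_ball_iff_norm] at hζ
    have hζη := (hball ζ (by linarith)).2.2
    have hsteps : ∀ j ≤ q, ‖φ^[j] ζ - ζ‖ ≤ j * η := by
      intro j
      induction j with
      | zero => simp
      | succ j ih =>
        intro hj
        have ih := ih (by omega)
        have hjq : (j : ℝ) ≤ q := by exact_mod_cast (by omega : j ≤ q)
        have h1 : ‖φ^[j] ζ - X‖ ≤ 4 := by
          calc ‖φ^[j] ζ - X‖ ≤ ‖φ^[j] ζ - ζ‖ + ‖ζ - X‖ := norm_sub_le_norm_sub_add_norm_sub _ _ _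
            _ ≤ 4 := by nlinarith
        rw [Function.iterate_succ_apply']
        calc _ ≤ ‖φ (φ^[j] ζ) - φ^[j] ζ‖ + ‖φ^[j] ζ - ζ‖ := norm_sub_le_norm_sub_add_norm_sub _ _ _
          _ ≤ η + j * η := add_le_add (hball _ h1).2.2 ih
          _ = _ := by push_cast; ring
    refine eq_zero_of_iterate_eq_self (B := Metric.closedBall (X : ℂ) 3) hq (fun z hz => ?_)
      (fun z hz => ?_) (hR' ζ (hball ζ (by linarith)).2.1 fun j hj => ?_)
    · refine (convex_closedBall (X : ℂ) 3).norm_image_sub_le_of_norm_deriv_le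
        (f := fun z => φ z - z) (fun w hw => hdiff w ?_) hderiv ?_ hz
      · rw [mem_closedBall_iff_norm] at hw; linarith
      · rw [mem_closedBall_iff_norm]; linarith
    · rw [mem_closedBall_iff_norm]
      calc ‖z - X‖ ≤ ‖z - ζ‖ + ‖ζ - X‖ := norm_sub_le_norm_sub_add_norm_sub _ _ _
        _ ≤ 3 := by nlinarith
    · refine (hball _ ?_).1
      have hjq : (j : ℝ) ≤ q := by exact_mod_cast hj.le
      calc ‖φ^[j] ζ - X‖ ≤ ‖φ^[j] ζ - ζ‖ + ‖ζ - X‖ := norm_sub_le_norm_sub_add_norm_sub _ _ _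
        _ ≤ 4 := by nlinarith [hsteps j hj.le]
  refine hφ.eqOn_of_preconnected_of_eventuallyEq analyticOnNhd_id (isPreconnected_quadGerm hC R)
    (hball X (by simp)).1 ?_
  filter_upwards [Metric.ball_mem_nhds (X : ℂ) one_pos] with ζ hζ using hzero ζ hζ

/-! ### Real germs -/

lemma tendsto_conj_atInfty {C : ℝ} (hC : 0 < C) : Tendsto conj (atInfty C) (atInfty C) := by
  rw [tendsto_atInfty_iff]
  refine ⟨by simpa using tendsto_re_atInfty C, ?_⟩
  filter_upwards [eventually_mem_quadGerm C 0] with ζ hζ using conj_mem_quadDomain hC hζ.1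

/-- A holomorphic germ that is real on the real axis commutes with the conjugation. -/
lemma PreservesRealPoints.eventually_conj {C : ℝ} (hC : 0 < C) {f : ℂ → ℂ}
    (hf : IsHolomorphicGerm C f) (hr : PreservesRealPoints C f) :
    ∃ R, ∀ ζ ∈ quadGerm C R, f (conj ζ) = conj (f ζ) := by
  obtain ⟨R₁, -, hf⟩ := hf
  obtain ⟨R₂, -, hr⟩ := hr
  refine ⟨R₁ + 1, ?_⟩
  have han : AnalyticOnNhd ℂ (conj ∘ f ∘ conj) (quadGerm C (R₁ + 1)) := by
    have hU : IsOpen (quadDomain C ∩ {ζ | R₁ < ζ.re}) :=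
      (isOpen_quadDomain hC).inter (isOpen_lt continuous_const Complex.continuous_re)
    have hd : DifferentiableOn ℂ (conj ∘ f ∘ conj) (quadDomain C ∩ {ζ | R₁ < ζ.re}) := by
      rintro ζ ⟨h1, h2⟩
      have h2 : R₁ < ζ.re := h2
      have h3 := (hf (conj ζ) (conj_mem_quadGerm hC ⟨h1, h2.le⟩)).differentiableAt.conj_conj
      rw [Complex.conj_conj] at h3
      exact h3.differentiableWithinAt
    refine (hd.analyticOnNhd hU).mono ?_
    rintro ζ ⟨h1, h2⟩
    have h2 : R₁ + 1 ≤ ζ.re := h2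
    exact ⟨h1, show R₁ < ζ.re by linarith⟩
  set x₀ : ℝ := max (max (R₁ + 1) R₂) C + 1 with hx₀
  have hm1 := le_max_left (max (R₁ + 1) R₂) C
  have hm2 := le_max_right (max (R₁ + 1) R₂) C
  have hm3 := le_max_left (R₁ + 1) R₂
  have hm4 := le_max_right (R₁ + 1) R₂
  have hx₀mem : (x₀ : ℂ) ∈ quadGerm C (R₁ + 1) :=
    ⟨ofReal_mem_quadDomain hC (by linarith), show R₁ + 1 ≤ (x₀ : ℂ).re by
      rw [Complex.ofReal_re]; linarith⟩
  -- `f` and its reflection agree at real points to the right of `x₀`, which accumulate at `x₀`.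
  have hfreq : ∃ᶠ z in 𝓝[≠] (x₀ : ℂ), f z = (conj ∘ f ∘ conj) z := by
    have ht : Tendsto (fun x : ℝ => (x : ℂ)) (𝓝[>] x₀) (𝓝[≠] (x₀ : ℂ)) := by
      refine tendsto_nhdsWithin_iff.2 ⟨?_, ?_⟩
      · exact (Complex.continuous_ofReal.tendsto x₀).mono_left nhdsWithin_le_nhds
      · filter_upwards [self_mem_nhdsWithin] with x hx
        have hx : x₀ < x := hx
        simpa using hx.ne'
    refine ht.frequently (Eventually.frequently ?_)
    filter_upwards [self_mem_nhdsWithin] with x hx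
    have hx : x₀ < x := hx
    have h := (hr (x : ℂ) ⟨ofReal_mem_quadDomain hC (by linarith), show R₂ ≤ (x : ℂ).re by
      rw [Complex.ofReal_re]; linarith⟩ (Complex.ofReal_im x)).2
    simp only [Function.comp_apply, Complex.conj_ofReal]
    exact (Complex.conj_eq_iff_im.2 h).symm
  have heq := (hf.mono (quadGerm_anti (by linarith))).eqOn_of_preconnected_of_frequently_eq han
    (isPreconnected_quadGerm hC (R₁ + 1)) hx₀mem hfreq
  intro ζ hζ
  have := heq (conj_mem_quadGerm hC hζ)
  simpa using this

/-- The real part of a polynomial, coefficientwise. -/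
def rePoly (P : Polynomial ℂ) : Polynomial ℝ :=
  ∑ i ∈ Finset.range (P.natDegree + 1), Polynomial.monomial i (P.coeff i).re

lemma eval_map_rePoly (P : Polynomial ℂ) (ζ : ℂ) :
    ((rePoly P).map (algebraMap ℝ ℂ)).eval ζ = (P.eval ζ + conj (P.eval (conj ζ))) / 2 := by
  rw [rePoly, Polynomial.map_sum, Polynomial.eval_finsetSum, P.eval_eq_sum_range,
    P.eval_eq_sum_range, map_sum, ← Finset.sum_add_distrib, Finset.sum_div]
  refine Finset.sum_congr rfl fun i _ => ?_
  have : (((P.coeff i).re : ℝ) : ℂ) = (P.coeff i + conj (P.coeff i)) / 2 := by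
    rw [Complex.re_eq_add_conj]
  simp only [Polynomial.map_monomial, Polynomial.eval_monomial, Complex.coe_algebraMap, this,
    map_mul, map_pow, Complex.conj_conj]
  ring

/-- The real part of a Dulac series, with real coefficients. -/
def Series.realPart (S : Series) : Series :=
  { S with β := S.β.re, P := fun i => (rePoly (S.P i)).map (algebraMap ℝ ℂ) }

lemma Series.partialSum_realPart (S : Series) (N : ℕ) (ζ : ℂ) :
    S.realPart.partialSum N ζ = (S.partialSum N ζ + conj (S.partialSum N (conj ζ))) / 2 := by
  simp only [Series.partialSum, Series.realPart, eval_map_rePoly, map_add, map_sum, map_mul,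
    Complex.conj_conj, Complex.conj_ofReal]
  have h1 : ((S.β.re : ℝ) : ℂ) = (S.β + conj S.β) / 2 := by rw [Complex.re_eq_add_conj]
  have h2 : ∀ i, conj (Complex.exp (-((S.a i : ℂ) * conj ζ))) =
      Complex.exp (-((S.a i : ℂ) * ζ)) := fun i => by
    rw [← Complex.exp_conj]; simp
  simp only [h1, h2]
  rw [show ∀ a b c d e g : ℂ, (a + b + c + (d + e + g)) / 2 =
    (a + d) / 2 + (b + e) / 2 + (c + g) / 2 by intros; ring, ← Finset.sum_add_distrib,
    Finset.sum_div]
  congr 1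
  · ring
  · exact Finset.sum_congr rfl fun i _ => by ring

/-- `φ` is the average of itself and its reflection, and averaging the partial sums gives those of
`realPart`; no uniqueness of expansions is involved. -/
lemma HasExpansion.realPart {C : ℝ} (hC : 0 < C) {φ : ℂ → ℂ} {S : Series}
    (hS : HasExpansion C φ S) {R : ℝ} (hφ : ∀ ζ ∈ quadGerm C R, φ (conj ζ) = conj (φ ζ)) :
    HasExpansion C φ S.realPart := by
  intro ν hν
  obtain ⟨N, hN⟩ := hS ν hν
  refine ⟨N, isLittleO_cexp_iff.2 ?_⟩
  rw [isLittleO_cexp_iff] at hN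
  have h1 := hN.comp_tendsto (tendsto_conj_atInfty hC)
  have h2 : (fun ζ => conj (φ (conj ζ) - S.partialSum N (conj ζ))) =o[atInfty C] decay ν := by
    refine (h1.congr_right fun ζ => by simp [decay]).norm_left.congr_left (fun ζ => ?_) |>.of_norm_left
    rw [RCLike.norm_conj]
    rfl
  refine ((hN.add h2).const_mul_left (1 / 2)).congr' ?_ EventuallyEq.rfl
  filter_upwards [eventually_mem_quadGerm C R] with ζ hζ
  rw [Series.partialSum_realPart, map_sub, hφ ζ hζ, Complex.conj_conj]
  ring

lemma HasExpansion.mono {C C' : ℝ} (hC : 0 < C) (h : C ≤ C') {φ : ℂ → ℂ} {S : Series}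
    (hS : HasExpansion C φ S) : HasExpansion C' φ S :=
  fun ν hν => (hS ν hν).imp fun _ hN => hN.mono (atInfty_anti hC h)

/-- A linearizing map of a germ that commutes with the conjugation commutes with it, too. -/
lemma IsLinearizationOn.eventually_conj {C R ρ : ℝ} (hC : 0 < C) {f φ : ℂ → ℂ} {β : ℂ}
    (hφ : IsLinearizationOn C R f β φ) (hp : Pushes C R ρ f) (hρ : 0 < ρ)
    (hf : ∀ ζ ∈ quadGerm C R, f (conj ζ) = conj (f ζ))
    (hfβ : Tendsto (fun ζ => f ζ - ζ - β) (atInfty C) (𝓝 0)) :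
    ∀ ζ ∈ quadGerm C R, φ (conj ζ) = conj (φ ζ) := by
  -- Symmetry of `f` makes the reflected displacement tend to both `conj β` and `β`.
  have hβ : conj β = β := by
    have h1 : Tendsto (fun ζ => conj (f (conj ζ) - conj ζ - β)) (atInfty C) (𝓝 0) := by
      rw [← map_zero conj]
      exact (Complex.continuous_conj.tendsto 0).comp (hfβ.comp (tendsto_conj_atInfty hC))
    have h2 : (fun ζ => conj (f (conj ζ) - conj ζ - β) - (f ζ - ζ - β)) =ᶠ[atInfty C]
        fun _ => β - conj β := by
      filter_upwards [eventually_mem_quadGerm C R] with ζ hζ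
      rw [map_sub, map_sub, hf ζ hζ, Complex.conj_conj, Complex.conj_conj]
      ring
    have h3 := (tendsto_congr' h2).1 (h1.sub hfβ)
    have : (atInfty C).NeBot := (tendsto_ofReal_atInfty hC).neBot
    rw [sub_zero, tendsto_const_nhds_iff] at h3
    exact (sub_eq_zero.1 h3).symm
  have hr : Tendsto (fun ζ => conj (φ (conj ζ)) - φ ζ) (atInfty C) (𝓝 0) := by
    have h1 : Tendsto (fun ζ => conj (φ (conj ζ) - conj ζ)) (atInfty C) (𝓝 0) := by
      rw [← map_zero conj]
      exact (Complex.continuous_conj.tendsto 0).comp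
        (hφ.tangent.comp (tendsto_conj_atInfty hC))
    simpa using h1.sub hφ.tangent
  intro ζ hζ
  have h := hp.eq_zero_of_invariant hρ hr (fun ζ hζ => by
    rw [← hf ζ hζ, hφ.linearizes _ (conj_mem_quadGerm hC hζ), hφ.linearizes _ hζ, map_add, hβ]
    ring) ζ hζ
  rw [← sub_eq_zero.1 h, Complex.conj_conj]

end Dulac

end

/-! ### Assembly of the theorem -/

theorem theoremB (C : ℝ) (hC : 0 < C) (β : ℂ) (hβ : 0 < β.re) (f : ℂ → ℂ)
    (hf : Dulac.IsComplexDulacGerm C f)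
    (hfβ : Tendsto (fun ζ => f ζ - ζ - β) (Dulac.atInfty C) (𝓝 0)) :
    ∃ R₀ : ℝ, 0 < R₀ ∧ ∃ φ : ℂ → ℂ,
      -- existence, on all sufficiently small germs of the domain, which are invariant
      (∀ R : ℝ, R₀ ≤ R → Dulac.IsLinearizationOn C R f β φ) ∧
      -- uniqueness
      (∀ R : ℝ, 0 < R → ∀ ψ : ℂ → ℂ, Dulac.IsLinearizationOn C R f β ψ →
        Set.EqOn ψ φ (Dulac.quadGerm C R ∩ Dulac.quadGerm C R₀)) ∧
      -- unless `f` is a translation, no iterate of `φ` is the identity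
      ((¬ ∀ᶠ ζ in Dulac.atInfty C, f ζ = ζ + β) → Dulac.NoIterateIsId C R₀ φ) ∧
      -- `φ` is a parabolic Dulac germ on a smaller standard quadratic domain, real if `f` is
      ∃ C' : ℝ, C ≤ C' ∧ Dulac.quadDomain C' ⊆ Dulac.quadGerm C R₀ ∧
        Dulac.IsParabolicDulacGerm C' φ ∧
        (Dulac.IsRealDulacGerm C f → Dulac.IsRealDulacGerm C' φ ∧
          ∃ S : Dulac.Series, S.IsParabolic ∧ S.IsReal ∧ Dulac.HasExpansion C' φ S) := by
  obtain ⟨⟨R₁, -, hfa⟩, S, hS⟩ := id hf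
  obtain ⟨s, hs, hmem⟩ := S.a_fg
  have hmem' := fun i => Dulac.mem_addSubmonoid_closure s (hmem i)
  have hδ := S.a_pos 0
  have hexp := hS.sub_mem_expandable hC hfβ hmem'
  -- Half of the first exponent, so that its polynomial factor is absorbed.
  have hε : 0 < S.a 0 / 2 := half_pos hδ
  obtain ⟨K, hK, hKO⟩ := (Dulac.expandable_isBigO hC (half_lt_self hδ) hexp).exists_nonneg
  obtain ⟨R₂, hR₂⟩ := Dulac.eventually_atInfty_iff.1 hKO.bound
  obtain ⟨R₃, hR₃⟩ := Dulac.exists_pushes hC hβ hfβ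
  have hρ : 0 < β.re / 2 := half_pos hβ
  set r : ℝ := max (max R₁ R₂) (max R₃ 0) with hr
  have hr₁ : R₁ ≤ r := (le_max_left _ _).trans (le_max_left _ _)
  have hr₂ : R₂ ≤ r := (le_max_right _ _).trans (le_max_left _ _)
  have hr₃ : R₃ ≤ r := (le_max_left _ _).trans (le_max_right _ _)
  have hr₀ : 0 ≤ r := (le_max_right _ _).trans (le_max_right _ _)
  have hp : Dulac.Pushes C r (β.re / 2) f := hR₃.mono hr₃
  have hg : ∀ ζ ∈ Dulac.quadGerm C r,
      ‖f ζ - ζ - β‖ ≤ K * Real.exp (-(S.a 0 / 2) * ζ.re) := fun ζ hζ => by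
    have := hR₂ ζ (Dulac.quadGerm_anti hr₂ hζ)
    rwa [Dulac.decay, Real.norm_eq_abs, Real.abs_exp] at this
  set φ := Dulac.linearization β f with hφ
  have htan := Dulac.tendsto_linearization_sub hp hρ hε hK hg
  have hana := Dulac.analyticOnNhd_linearization hC hp hρ hε hK hg
    (hfa.mono (Dulac.quadGerm_anti hr₁)) (lt_add_one r)
  have hlin : ∀ ζ ∈ Dulac.quadGerm C r, φ (f ζ) = φ ζ + β := fun ζ hζ =>
    Dulac.linearization_comp hp hρ hε hK hg hζ
  -- The shift to `r + 1` leaves the left edge of the germ of level `r`, where analyticity is not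
  -- available, and makes `R₀` positive.
  have hIs : ∀ R : ℝ, r + 1 ≤ R → Dulac.IsLinearizationOn C R f β φ := fun R hR =>
    { invariant := (hp.mono (by linarith : r ≤ R)).mapsTo hρ.le
      analytic := hana.mono (Dulac.quadGerm_anti hR)
      tangent := htan
      linearizes := fun ζ hζ => hlin ζ (Dulac.quadGerm_anti (by linarith) hζ) }
  -- `R_{C'}` lies in `Re ζ > C'`, so `C' ≥ r + 1` suffices.
  have hsub : Dulac.quadDomain (max C (r + 1)) ⊆ Dulac.quadGerm C (r + 1) := fun ζ hζ =>
    ⟨Dulac.quadDomain_anti hC (le_max_left _ _) hζ, (le_max_right _ _).trans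
      ((Dulac.mem_quadDomain_iff (hC.trans_le (le_max_left _ _))).1 hζ).1.le⟩
  have hCC' : C ≤ max C (r + 1) := le_max_left _ _
  have hhol : Dulac.IsHolomorphicGerm (max C (r + 1)) φ :=
    ⟨r + 1, by linarith, hana.mono fun ζ hζ => hsub hζ.1⟩
  obtain ⟨T, hTpar, hT⟩ := Dulac.exists_series_of_mem_expandable hC hs hδ (hmem' 0)
    (Dulac.sub_id_mem_expandable hC hβ hδ hexp hp hρ htan hlin)
  refine ⟨r + 1, by linarith, φ, hIs, ?_, ?_, max C (r + 1), hCC', hsub,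
    ⟨hhol, T, hTpar, hT.mono hC hCC'⟩, ?_⟩
  · rintro R - ψ hψ ζ ⟨h1, h2⟩
    refine sub_eq_zero.1 ((hp.mono (le_max_right R r)).eq_zero_of_invariant hρ
      (r := fun ζ => ψ ζ - φ ζ) ?_ (fun ζ hζ => ?_) ζ
      ⟨h1.1, show max R r ≤ ζ.re from
        max_le h1.2 ((le_add_of_nonneg_right zero_le_one).trans h2.2)⟩)
    · simpa using hψ.tangent.sub htan
    · rw [hψ.linearizes ζ (Dulac.quadGerm_anti (le_max_left _ _) hζ),
        hlin ζ (Dulac.quadGerm_anti (le_max_right _ _) hζ)]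
      ring
  · intro hne
    by_contra hno
    have hid := Dulac.eqOn_id_of_not_noIterateIsId hC hana htan hno
    refine hne (Dulac.eventually_atInfty_iff.2 ⟨r + 1, fun ζ hζ => ?_⟩)
    -- With `φ = id` the linearization equation reads `f ζ = ζ + β`.
    have h := (hIs _ le_rfl).linearizes ζ hζ
    rwa [show φ (f ζ) = f ζ from hid ((hIs _ le_rfl).invariant hζ),
      show φ ζ = ζ from hid hζ] at h
  · rintro ⟨⟨hfhol, -⟩, hreal⟩
    obtain ⟨R₄, hR₄⟩ := hreal.eventually_conj hC hfhol
    have hconj := (hIs _ (le_max_left (r + 1) R₄)).eventually_conj hC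
      (hp.mono ((le_add_of_nonneg_right zero_le_one).trans (le_max_left _ _))) hρ
      (fun ζ hζ => hR₄ ζ (Dulac.quadGerm_anti (le_max_right _ _) hζ)) hfβ
    have hTre := (hT.realPart hC hconj).mono hC hCC'
    refine ⟨⟨⟨hhol, T, hT.mono hC hCC'⟩, ?_⟩, T.realPart, ⟨hTpar.1, ?_⟩,
      ⟨⟨0, le_rfl, ?_⟩, fun i => ⟨_, rfl⟩⟩, hTre⟩
    -- Real points with `Re ζ ≥ C' + 1` move by less than `1`, so their images are real numbers
    -- larger than `C'`.
    · obtain ⟨R₅, hR₅⟩ := Dulac.eventually_atInfty_iff.1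
        (htan.norm.eventually (gt_mem_nhds (by simp : ‖(0 : ℂ)‖ < 1)))
      refine ⟨max (max (max (r + 1) R₄) R₅) (max C (r + 1) + 1), ?_, fun ζ hζ him => ?_⟩
      · have h1 := le_max_right (max (max (r + 1) R₄) R₅) (max C (r + 1) + 1)
        linarith
      · have hζC : ζ ∈ Dulac.quadGerm C (max (max (max (r + 1) R₄) R₅) (max C (r + 1) + 1)) :=
          ⟨Dulac.quadDomain_anti hC hCC' hζ.1, hζ.2⟩
        have h1 := hconj ζ
          (Dulac.quadGerm_anti ((le_max_left _ _).trans (le_max_left _ _)) hζC)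
        rw [Complex.conj_eq_iff_im.2 him] at h1
        have h2 := Complex.conj_eq_iff_re.1 h1.symm
        have h3 := (abs_lt.1 ((Complex.abs_re_le_norm _).trans_lt (hR₅ ζ
          (Dulac.quadGerm_anti ((le_max_right _ _).trans (le_max_left _ _)) hζC)))).1
        have h4 : max C (r + 1) + 1 ≤ ζ.re := (le_max_right _ _).trans hζ.2
        rw [Complex.sub_re] at h3
        refine ⟨?_, Complex.conj_eq_iff_im.1 h1.symm⟩
        rw [← h2]
        exact Dulac.ofReal_mem_quadDomain (hC.trans_le hCC') (by linarith)
    · simp [Dulac.Series.realPart, hTpar.2]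
    · simp [Dulac.Series.realPart, hTpar.2]
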